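/- Let $\mathcal H=(\mathcal X,\mathcal F)$ be a finite hypergraph and let $b\ge 1$ be an integer. The multistage $(1:b)$ Maker--Breaker game on $\mathcal H$ is played as follows. Put $\mathcal X_0=\mathcal X$ and $\mathcal F_0=\mathcal F$. In stage $i\ge 1$, two players alternately claim previously unclaimed elements of the board $\mathcal X_{i-1}$, with Maker moving first: in each move Maker claims exactly one unclaimed element and Breaker claims at most $b$ unclaimed elements, until all elements of $\mathcal X_{i-1}$ are claimed. Then $\mathcal X_i$ is the set of elements claimed by Maker in stage $i$, and $\mathcal F_i=\{F\in\mathcal F_{i-1}: F\subseteq \mathcal X_i\}$. Let $\tau(\mathcal H,b)$ be the largest integer $s\ge 0$ such that Maker has a strategy that ensures $\mathcal F_s\neq\varnothing$. For $n\ge 3$ let $\mathcal{HAM}_n$ be the hypergraph whose vertex set is the edge set of the complete graph $K_n$ and whose hyperedges are the edge sets of all Hamilton cycles of $K_n$. **Theorem.** Let $b=b(n)\ge 1$ be an integer-valued function that is subpolynomial in $n$, that is, $b(n)=o(n^{\varepsilon})$ as $n\to\infty$ for every fixed $\varepsilon>0$. Then $\tau(\mathcal{HAM}_n,b(n))$ is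 well defined (the maximum exists) for every $n\ge 3$, and $$\tau(\mathcal{HAM}_n,b(n))=(1+o(1))\,\log_{b(n)+1}(n)\qquad\text{as } n\to\infty .$$ -/

import Mathlib

open Filter Asymptotics

namespace MultistageGame

/-- One stage of a `(1:b)` Maker-Breaker game, seen from a position with Maker to move, in which
`U` is the set of unclaimed elements and `M` the set of elements claimed by Maker in this stage.
`MakerForces b P U M` says that Maker has a strategy from this position under which, whatever
Breaker does, the set of all elements claimed by Maker at the end of the stage satisfies `P`.
A derivation of `MakerForces b P U M` is such a strategy, written as a tree: at every position
that can be reached it names the one element `x` that Maker claims, and it then has one branch for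
each reply of Breaker, who claims a set `B` of at most `b` unclaimed elements. The stage ends when
all the elements of the board are claimed. -/
inductive MakerForces {α : Type*} (b : ℕ) (P : Set α → Prop) : Set α → Set α → Prop
  | stageOver (M : Set α) (hM : P M) : MakerForces b P ∅ M
  | round (U M : Set α) (x : α) (hx : x ∈ U)
      (h : ∀ B : Set α, B ⊆ U \ {x} → B.encard ≤ (b : ℕ∞) →
        MakerForces b P ((U \ {x}) \ B) (insert x M)) :
      MakerForces b P U M

/-- The hypergraph on which the next stage is played, if Maker's elements at the end of the current
stage form the set `M`: the board is `M`, and the winning sets are those contained in `M`. -/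
def reduce {α : Type*} (H : Hypergraph α) (M : Set α) : Hypergraph α where
  vertexSet := M
  edgeSet := {F | F ∈ H.edgeSet ∧ F ⊆ M}
  subset_vertexSet_of_mem_edgeSet' := fun _ hF => hF.2

/-- In the multistage `(1:b)` Maker-Breaker game on the (finite) hypergraph `H`, Maker has a strategy
to ensure that there is a winning set left after `s` stages. Each stage starts with Maker's move, on
a board all of whose elements are unclaimed. The families of remaining winning sets decrease, so
if a winning set is left after `s` stages then the game has not stopped before. -/
def MakerLasts {α : Type*} (b : ℕ) : ℕ → Hypergraph α → Prop
  | 0, H => H.edgeSet.Nonempty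
  | s + 1, H => MakerForces b (fun M => MakerLasts b s (reduce H M)) H.vertexSet ∅

/-- The threshold `τ(H, b)`: the largest `s` such that Maker has a strategy to ensure that there is a
winning set left after `s` stages. (It is a genuine maximum whenever the set of such `s` is nonempty
and bounded.) -/
noncomputable def tau {α : Type*} (H : Hypergraph α) (b : ℕ) : ℕ :=
  sSup {s : ℕ | MakerLasts b s H}

/-- The Hamilton cycle hypergraph: its vertices are the edges of the complete graph `K_n`,
its hyperedges are the edge sets of the Hamilton cycles of `K_n`. -/
def HAM (n : ℕ) : Hypergraph (Sym2 (Fin n)) where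
  vertexSet := (SimpleGraph.completeGraph (Fin n)).edgeSet
  edgeSet := {F | ∃ (v : Fin n) (p : (SimpleGraph.completeGraph (Fin n)).Walk v v),
    p.IsHamiltonianCycle ∧ F = p.edgeSet}
  subset_vertexSet_of_mem_edgeSet' := by
    rintro _ ⟨v, p, -, rfl⟩ e he
    exact p.edges_subset_edgeSet he

/-- `b` is subpolynomial in `n`: `b n = o(n ^ ε)` as `n → ∞`, for every `ε > 0`. -/
def Subpolynomial (b : ℕ → ℕ) : Prop :=
  ∀ ε : ℝ, 0 < ε → (fun n : ℕ => (b n : ℝ)) =o[atTop] (fun n : ℕ => (n : ℝ) ^ ε)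

end MultistageGame

/-!
Breaker's side is a count: if he claims `b` elements whenever he can, Maker gets at most one out of
every `b + 1` elements, rounded up, so the board minus one element shrinks by the factor `b + 1` in
each stage. As a Hamilton cycle has `n` edges, Maker survives at most `log_{b + 1} n` stages
(`pow_le_of_makerLasts`).

On Maker's side, a potential of Erdős–Selfridge type shows that in a stage she can claim a fraction
`(1 - δ) / (b + 1)` of every set of a given family, provided that the family satisfies an
exponential union bound (`exists_potential_le`, `makerForces_fraction`). So during `s` stages she
keeps the fraction `((1 - δ) / (b + 1)) ^ s` of each set of the family, and this while only a
tracked subset of the board, of size about `n ^ 2 / (b + 1) ^ s`, is taken into account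
(`makerLasts_of_fraction`). For `s` about `(1 - ε) log_{b + 1} n` the tracked graph has average
degree about `n ^ ε`, up to small powers of `n`, which leaves room for a family with two kinds of
sets:

* for `#A` at most about `n / 4` and `#B ≤ 2 * #A`, the edges between `A` and the complement of
  `A ∪ B`; meeting all of them makes a graph an expander;
* for every expander `Γ` with at most `m` edges, the boosters of `Γ`, that is the edges whose
  addition makes `Γ` Hamiltonian or its longest path longer. By Pósa's rotations
  (`IsLongestPath.exists_mem_pathEdges`) there are quadratically many
  (`Expands.le_card_boosters`).

The final graph can be thinned out to an expander with few edges: the strategy of a single stage,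
with a larger bias and an idle Breaker, yields one (`exists_thinning`). The final graph contains a
booster of it, and again of the graph with this booster added, and so on; after at most `n`
additions a Hamilton cycle arises (`hasHamiltonCycle_of_boosters`). Only sparse `Γ` occur here,
which is what makes the union bound over all of them affordable (`makerLasts_HAM`).
-/

namespace MultistageGame

open scoped Finset

section Game

variable {α ι : Type*}

/-! ### One stage of the game -/

lemma MakerForces.mono {b : ℕ} {P Q : Set α → Prop} {U M : Set α} (h : MakerForces b P U M)
    (hPQ : ∀ M, P M → Q M) : MakerForces b Q U M := by
  induction h with
  | stageOver M hM => exact .stageOver M (hPQ M hM)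
  | round U M x hx _ ih => exact .round U M x hx ih

/-- On a finite board, Maker ends up with a finite set. -/
lemma MakerForces.and_finite {b : ℕ} {P : Set α → Prop} {U M : Set α} (h : MakerForces b P U M)
    (hU : U.Finite) (hM : M.Finite) : MakerForces b (fun N => P N ∧ N.Finite) U M := by
  induction h with
  | stageOver M h => exact .stageOver M ⟨h, hM⟩
  | round U M x hx h ih =>
    exact .round U M x hx fun B hB hBb => ih B hB hBb hU.sdiff.sdiff (hM.insert x)

/-- If a round uses up one of `u + 1` elements and then `b` others, or all that are left, the
number of elements over `b + 1`, rounded up, decreases by at least one. -/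
lemma sub_min_add_div_add_one_le (b u : ℕ) :
    (u - min b u + b) / (b + 1) + 1 ≤ (u + 1 + b) / (b + 1) := by
  rcases le_total b u with hbu | hbu
  · rw [min_eq_left hbu, Nat.sub_add_cancel hbu,
      show u + 1 + b = u + (b + 1) by ring, Nat.add_div_right _ (Nat.succ_pos b)]
  · rw [min_eq_right hbu, Nat.sub_self, Nat.zero_add, Nat.div_eq_of_lt (Nat.lt_succ_self b)]
    exact (Nat.le_div_iff_mul_le (Nat.succ_pos b)).2 (by omega)

/-- Breaker claims `b` elements in every round while he can, so that Maker gets at most one element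
out of every `b + 1`, rounded up. -/
lemma MakerForces.exists_card_le {b : ℕ} {P : Set α → Prop} {U M : Set α}
    (h : MakerForces b P U M) (hU : U.Finite) (hM : M.Finite) :
    ∃ N : Set α, P N ∧ N.Finite ∧ N.ncard ≤ M.ncard + (U.ncard + b) / (b + 1) := by
  induction h with
  | stageOver M hP => exact ⟨M, hP, hM, Nat.le_add_right _ _⟩
  | round U M x hx h ih =>
    have hUx : (U \ {x}).Finite := hU.sdiff
    have hcard : (U \ {x}).ncard + 1 = U.ncard := Set.ncard_sdiff_singleton_add_one hx hU
    obtain ⟨B, hBU, hB⟩ := Set.exists_subset_card_eq (s := U \ {x})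
      (n := min b (U \ {x}).ncard) (min_le_right _ _)
    have hBfin : B.Finite := hUx.subset hBU
    have hBb : B.encard ≤ (b : ℕ∞) := by
      rw [← hBfin.cast_ncard_eq]
      exact_mod_cast hB.le.trans (min_le_left _ _)
    obtain ⟨N, hPN, hN, hle⟩ := ih B hBU hBb hUx.sdiff (hM.insert x)
    refine ⟨N, hPN, hN, hle.trans ?_⟩
    have h1 : (insert x M).ncard ≤ M.ncard + 1 := Set.ncard_insert_le x M
    have h2 : ((U \ {x}) \ B).ncard = (U \ {x}).ncard - B.ncard := Set.ncard_sdiff hBU hBfin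
    rw [h2, hB]
    have h3 := sub_min_add_div_add_one_le b (U \ {x}).ncard
    rw [hcard] at h3
    omega

/-- If every winning set has at least `n ≥ 2` elements, Maker survives `s` stages only on a board
with at least `(b + 1) ^ s * (n - 1) + 1` elements. -/
lemma MakerLasts.pow_mul_le {b n : ℕ} (s : ℕ) (H : Hypergraph α) (hfin : H.vertexSet.Finite)
    (hn : ∀ F ∈ H.edgeSet, n ≤ F.ncard) (h : MakerLasts b s H) :
    (b + 1) ^ s * (n - 1) ≤ H.vertexSet.ncard - 1 := by
  induction s generalizing H with
  | zero =>
    obtain ⟨F, hF⟩ := h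
    have h1 := hn F hF
    have h2 := Set.ncard_le_ncard (H.subset_vertexSet_of_mem_edgeSet' hF) hfin
    simp only [pow_zero, one_mul]
    omega
  | succ s ih =>
    obtain ⟨N, hP, hN, hle⟩ := MakerForces.exists_card_le h hfin Set.finite_empty
    have h1 : (b + 1) ^ s * (n - 1) ≤ N.ncard - 1 :=
      ih (reduce H N) hN (fun F hF => hn F hF.1) hP
    rw [Set.ncard_empty, zero_add] at hle
    have h2 : (b + 1) * (N.ncard - 1) ≤ H.vertexSet.ncard - 1 := by
      have h3 := (Nat.le_div_iff_mul_le (Nat.succ_pos b)).1 hle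
      rw [Nat.mul_sub, mul_one]
      have h4 : (b + 1) * N.ncard ≤ H.vertexSet.ncard + b := by rw [mul_comm]; exact h3
      omega
    calc (b + 1) ^ (s + 1) * (n - 1) = (b + 1) * ((b + 1) ^ s * (n - 1)) := by ring
      _ ≤ (b + 1) * (N.ncard - 1) := Nat.mul_le_mul_left _ h1
      _ ≤ _ := h2

/-! ### The potential of Maker's strategy -/

section Potential

variable [DecidableEq α]

/-- The weight of a set `F` at a position in which, among the elements that Maker keeps track of,
those in `U` are unclaimed and those in `M` are claimed by Maker. -/
noncomputable def weight (η ζ : ℝ) (F U M : Finset α) : ℝ :=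
  Real.exp (-(η * #(F ∩ U)) - ζ * #(F ∩ M))

/-- The potential of a position: the sum of the weights of the sets `F i` with coefficients
`c i`. It is small if Maker has, or can still get, many elements of each set. -/
noncomputable def potential (I : Finset ι) (c : ι → ℝ) (F : ι → Finset α) (η ζ : ℝ)
    (U M : Finset α) : ℝ :=
  ∑ i ∈ I, c i * weight η ζ (F i) U M

lemma exp_mul_le_one_add {η : ℝ} {b j : ℕ} (hb : 1 ≤ b) (hj : j ≤ b) :
    Real.exp (η * j) ≤ 1 + j / b * (Real.exp (η * b) - 1) := by
  have hb' : (0 : ℝ) < b := by exact_mod_cast hb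
  have hj' : (j : ℝ) ≤ b := by exact_mod_cast hj
  have h := convexOn_exp.2 (Set.mem_univ (0 : ℝ)) (Set.mem_univ (η * b))
    (show (0 : ℝ) ≤ 1 - j / b by rw [sub_nonneg, div_le_one hb']; exact hj')
    (show (0 : ℝ) ≤ j / b by positivity) (by ring)
  simp only [smul_eq_mul, mul_zero, zero_add, Real.exp_zero, mul_one] at h
  have h2 : (j : ℝ) / b * (η * b) = η * j := by field_simp
  rw [h2] at h
  linarith

/-- The change of the weight of one set when Maker claims `x` and then Breaker claims `B`, with the
factor `exp (η * #(F ∩ B))` of Breaker's move linearized by convexity. -/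
lemma weight_move_le {η ζ : ℝ} {b : ℕ} (hb : 1 ≤ b) (hηζ : η ≤ ζ)
    {F U M B : Finset α} {x : α} (hx : x ∈ U) (hxM : x ∉ M) (hB : B ⊆ U \ {x}) (hBb : #B ≤ b)
    (hη : 0 ≤ η) :
    weight η ζ F ((U \ {x}) \ B) (insert x M) ≤ weight η ζ F U M *
      (1 - (1 - Real.exp (η - ζ)) * (if x ∈ F then 1 else 0)
        + #(F ∩ B) / b * (Real.exp (η * b) - 1)) := by
  have hjb : #(F ∩ B) ≤ b := (Finset.card_le_card Finset.inter_subset_right).trans hBb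
  have h1 := exp_mul_le_one_add (η := η) hb hjb
  have hT : 0 ≤ Real.exp (η * b) - 1 := by
    rw [sub_nonneg]; exact Real.one_le_exp (by positivity)
  have hp : Real.exp (η - ζ) ≤ 1 := Real.exp_le_one_iff.2 (by linarith)
  have hBF : F ∩ B ⊆ (F ∩ U) \ {x} := by
    intro y hy
    have := hB (Finset.mem_inter.1 hy).2
    simp only [Finset.mem_sdiff, Finset.mem_singleton, Finset.mem_inter] at this ⊢
    exact ⟨⟨(Finset.mem_inter.1 hy).1, this.1⟩, this.2⟩
  have hsplit : F ∩ ((U \ {x}) \ B) = ((F ∩ U) \ {x}) \ (F ∩ B) := by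
    ext y; simp only [Finset.mem_sdiff, Finset.mem_singleton, Finset.mem_inter]; tauto
  have hc : (#(F ∩ ((U \ {x}) \ B)) : ℝ) = #((F ∩ U) \ {x}) - #(F ∩ B) := by
    rw [hsplit, Finset.cast_card_sdiff hBF]
  by_cases hxF : x ∈ F
  · have hc1 : (#((F ∩ U) \ {x}) : ℝ) = #(F ∩ U) - 1 := by
      rw [Finset.cast_card_sdiff (by simp [hx, hxF]), Finset.card_singleton, Nat.cast_one]
    have hc2 : (#(F ∩ insert x M) : ℝ) = #(F ∩ M) + 1 := by
      rw [Finset.inter_insert_of_mem hxF, Finset.card_insert_of_notMem (by simp [hxM])]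
      push_cast; ring
    have hw : weight η ζ F ((U \ {x}) \ B) (insert x M) =
        weight η ζ F U M * (Real.exp (η - ζ) * Real.exp (η * #(F ∩ B))) := by
      unfold weight
      rw [hc, hc1, hc2, ← Real.exp_add, ← Real.exp_add]
      congr 1; ring
    rw [hw, if_pos hxF, mul_one]
    refine mul_le_mul_of_nonneg_left ?_ (Real.exp_pos _).le
    calc Real.exp (η - ζ) * Real.exp (η * #(F ∩ B))
        ≤ Real.exp (η - ζ) * (1 + #(F ∩ B) / b * (Real.exp (η * b) - 1)) :=
          mul_le_mul_of_nonneg_left h1 (Real.exp_pos _).le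
      _ ≤ _ := by
          have : 0 ≤ (#(F ∩ B) : ℝ) / b * (Real.exp (η * b) - 1) := by positivity
          nlinarith
  · have hc1 : (F ∩ U) \ {x} = F ∩ U := by
      rw [Finset.sdiff_singleton_eq_erase, Finset.erase_eq_of_notMem (by simp [hxF])]
    have hw : weight η ζ F ((U \ {x}) \ B) (insert x M) =
        weight η ζ F U M * Real.exp (η * #(F ∩ B)) := by
      unfold weight
      rw [hc, hc1, Finset.inter_insert_of_notMem hxF, ← Real.exp_add]
      congr 1; ring
    rw [hw, if_neg hxF, mul_zero, sub_zero]
    exact mul_le_mul_of_nonneg_left h1 (Real.exp_pos _).le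

/-- If Maker claims the element in which the total weight of the sets containing it is largest, the
potential does not increase during a round: Breaker's gain, by convexity, is at most
`exp (η b) - 1` times this total weight. -/
lemma exists_potential_le (I : Finset ι) {c : ι → ℝ} (hc : ∀ i ∈ I, 0 ≤ c i) (F : ι → Finset α)
    {η ζ : ℝ} {b : ℕ} (hb : 1 ≤ b) (hη : 0 ≤ η)
    (hbal : Real.exp (η * b) + Real.exp (η - ζ) ≤ 2)
    {U M : Finset α} (hU : U.Nonempty) (hUM : Disjoint U M) :
    ∃ x ∈ U, ∀ B ⊆ U \ {x}, #B ≤ b →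
      potential I c F η ζ ((U \ {x}) \ B) (insert x M) ≤ potential I c F η ζ U M := by
  set w : ι → ℝ := fun i => c i * weight η ζ (F i) U M with hw
  have hw0 : ∀ i ∈ I, 0 ≤ w i := fun i hi => mul_nonneg (hc i hi) (Real.exp_pos _).le
  set Ψ : α → ℝ := fun y => ∑ i ∈ I, w i * (if y ∈ F i then 1 else 0) with hΨ
  obtain ⟨x, hx, hmax⟩ := U.exists_max_image Ψ hU
  refine ⟨x, hx, fun B hB hBb => ?_⟩
  have hT : 0 ≤ Real.exp (η * b) - 1 := by
    rw [sub_nonneg]; exact Real.one_le_exp (by positivity)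
  have hb' : (0 : ℝ) < b := by exact_mod_cast hb
  have hηζ : η ≤ ζ := by
    have : Real.exp (η - ζ) ≤ 1 := by linarith
    linarith [Real.exp_le_one_iff.1 this]
  have hΨx : 0 ≤ Ψ x := Finset.sum_nonneg fun i hi => by
    have := hw0 i hi
    positivity
  have hsumB : ∑ i ∈ I, w i * #(F i ∩ B) = ∑ y ∈ B, Ψ y := by
    rw [hΨ, Finset.sum_comm]
    refine Finset.sum_congr rfl fun i _ => ?_
    rw [← Finset.mul_sum, Finset.sum_boole, Finset.filter_mem_eq_inter, Finset.inter_comm]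
  have hB' : ∑ y ∈ B, Ψ y ≤ b * Ψ x := by
    calc ∑ y ∈ B, Ψ y ≤ #B • Ψ x := Finset.sum_le_card_nsmul _ _ _ fun y hy =>
          hmax y (Finset.sdiff_subset (hB hy))
      _ = #B * Ψ x := nsmul_eq_mul _ _
      _ ≤ b * Ψ x := mul_le_mul_of_nonneg_right (by exact_mod_cast hBb) hΨx
  calc potential I c F η ζ ((U \ {x}) \ B) (insert x M)
      ≤ ∑ i ∈ I, (w i - (1 - Real.exp (η - ζ)) * (w i * (if x ∈ F i then 1 else 0))
        + (Real.exp (η * b) - 1) / b * (w i * #(F i ∩ B))) := by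
        refine Finset.sum_le_sum fun i hi => ?_
        have h := mul_le_mul_of_nonneg_left (weight_move_le (F := F i) hb hηζ hx
          (Finset.disjoint_left.1 hUM hx) hB hBb hη) (hc i hi)
        refine h.trans (le_of_eq ?_)
        rw [hw]; ring
    _ = potential I c F η ζ U M - (1 - Real.exp (η - ζ)) * Ψ x
        + (Real.exp (η * b) - 1) / b * ∑ y ∈ B, Ψ y := by
        rw [Finset.sum_add_distrib, Finset.sum_sub_distrib, ← Finset.mul_sum, ← Finset.mul_sum,
          hsumB]
        rfl
    _ ≤ potential I c F η ζ U M - (1 - Real.exp (η - ζ)) * Ψ x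
        + (Real.exp (η * b) - 1) / b * (b * Ψ x) := by gcongr
    _ = potential I c F η ζ U M + (Real.exp (η * b) + Real.exp (η - ζ) - 2) * Ψ x := by
        field_simp; ring
    _ ≤ _ := by nlinarith

/-- Maker can play a stage such that her elements contain a set `N` of tracked elements that is
not too large, and at which the potential is less than `1`. Elements that Breaker could
have claimed but did not are dropped from the tracked set. -/
lemma makerForces_potential (I : Finset ι) {c : ι → ℝ} (hc : ∀ i ∈ I, 0 ≤ c i)
    (F : ι → Finset α) {η ζ : ℝ} {b : ℕ} (hb : 1 ≤ b) (hη : 0 ≤ η)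
    (hbal : Real.exp (η * b) + Real.exp (η - ζ) ≤ 2) (X : Finset α) (C : ℕ) :
    ∀ (V U N : Finset α) (M : Set α), U ⊆ V → U ⊆ X → N ⊆ X → (N : Set α) ⊆ M → Disjoint U N →
      potential I c F η ζ U N < 1 → #N + (#U + b) / (b + 1) ≤ C →
      MakerForces b (fun M => ∃ N : Finset α, (N : Set α) ⊆ M ∧ N ⊆ X ∧ #N ≤ C ∧
        potential I c F η ζ ∅ N < 1) V M := by
  intro V
  induction V using Finset.strongInduction with
  | H V ih =>
  intro U N M hUV hUX hNX hNM hUN hpot hC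
  -- the position after Maker's move `x` and Breaker's move `B`
  have key : ∀ x ∈ V, ∀ B : Set α, B ⊆ (V : Set α) \ {x} → ∃ B' : Finset α, (B' : Set α) = B ∧
      (((V : Set α) \ {x}) \ B) = (((V \ {x}) \ B' : Finset α) : Set α) ∧
      (V \ {x}) \ B' ⊂ V := by
    intro x hx B hB
    have hBfin : B.Finite := (V.finite_toSet.sdiff).subset hB
    refine ⟨hBfin.toFinset, hBfin.coe_toFinset, by simp, ?_⟩
    refine (Finset.ssubset_iff_of_subset
      (Finset.sdiff_subset.trans Finset.sdiff_subset)).2 ⟨x, hx, by simp⟩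
  rcases U.eq_empty_or_nonempty with rfl | hU
  · have hNC : #N ≤ C := (Nat.le_add_right _ _).trans hC
    rcases V.eq_empty_or_nonempty with rfl | ⟨x, hx⟩
    · rw [Finset.coe_empty]
      exact .stageOver M ⟨N, hNM, hNX, hNC, hpot⟩
    · refine .round _ _ x hx fun B hB _ => ?_
      obtain ⟨B', rfl, h1, h2⟩ := key x hx B hB
      rw [h1]
      exact ih _ h2 ∅ N _ (Finset.empty_subset _) hUX hNX (hNM.trans (Set.subset_insert _ _)) hUN
        hpot hC
  · obtain ⟨x, hx, hstep⟩ := exists_potential_le I hc F hb hη hbal hU hUN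
    refine .round _ _ x (hUV hx) fun B hB hBb => ?_
    obtain ⟨B', rfl, h1, h2⟩ := key x (hUV hx) B hB
    rw [h1]
    rw [Set.encard_coe_eq_coe_finsetCard, Nat.cast_le] at hBb
    have hI : #(B' ∩ (U \ {x})) ≤ min b #(U \ {x}) :=
      le_min ((Finset.card_le_card Finset.inter_subset_left).trans hBb)
        (Finset.card_le_card Finset.inter_subset_right)
    obtain ⟨D, hBD, hDU, hD⟩ := Finset.exists_subsuperset_card_eq
      (Finset.inter_subset_right (s₁ := B') (s₂ := U \ {x})) hI (min_le_right _ _)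
    have hUD : (U \ {x}) \ D ⊆ U := Finset.sdiff_subset.trans Finset.sdiff_subset
    refine ih _ h2 ((U \ {x}) \ D) (insert x N) _ ?_ (hUD.trans hUX) ?_ ?_ ?_ ?_ ?_
    · intro y hy
      simp only [Finset.mem_sdiff, Finset.mem_singleton] at hy ⊢
      refine ⟨⟨hUV hy.1.1, hy.1.2⟩, fun hyB => hy.2 (hBD ?_)⟩
      simp [hyB, hy.1.1, hy.1.2]
    · exact Finset.insert_subset (hUX hx) hNX
    · rw [Finset.coe_insert]
      exact Set.insert_subset_insert hNM
    · rw [Finset.disjoint_insert_right]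
      exact ⟨by simp, hUN.mono_left hUD⟩
    · exact (hstep D hDU (hD.le.trans (min_le_left _ _))).trans_lt hpot
    · have hu : #(U \ {x}) + 1 = #U := by
        rw [Finset.sdiff_singleton_eq_erase, Finset.card_erase_add_one hx]
      have hN' : #(insert x N) ≤ #N + 1 := Finset.card_insert_le _ _
      rw [Finset.card_sdiff_of_subset hDU, hD]
      have h3 := sub_min_add_div_add_one_le b #(U \ {x})
      rw [hu] at h3
      omega

/-- The factors `exp (-(a + 3 * a ^ 2))` of a move of Maker and `exp a` of a move of Breaker are
balanced as `exists_potential_le` needs it. -/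
lemma exp_add_exp_neg_le_two {a : ℝ} (h0 : 0 ≤ a) (h1 : a ≤ 1 / 8) :
    Real.exp a + Real.exp (-(a + 3 * a ^ 2)) ≤ 2 := by
  have e1 : Real.exp a ≤ 1 + a + a ^ 2 := by
    have h := Real.abs_exp_sub_one_sub_id_le (x := a) (by rw [abs_of_nonneg h0]; linarith)
    linarith [(abs_le.1 h).2]
  have e2 : Real.exp (-(a + 3 * a ^ 2)) ≤ 1 / (1 + (a + 3 * a ^ 2)) := by
    rw [Real.exp_neg, ← one_div]
    exact one_div_le_one_div_of_le (by positivity)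
      (by linarith [Real.add_one_le_exp (a + 3 * a ^ 2)])
  have e3 : 1 / (1 + (a + 3 * a ^ 2)) ≤ 1 - a - a ^ 2 := by
    rw [div_le_iff₀ (by positivity)]
    nlinarith [pow_nonneg h0 3, mul_nonneg h0 h0, mul_nonneg (mul_nonneg h0 h0) (sub_nonneg.2 h1)]
  linarith

/-- Maker can play a stage such that her elements contain a set `N` of at most about
`#X / (b + 1)` elements of `X`, which contains almost the fraction `1 / (b + 1)` of each set
`F i ∩ X`. The coefficients `c i` of the potential are chosen such that a set of which she gets
less contributes at least `1` at the end. -/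
lemma makerForces_fraction (I : Finset ι) (F : ι → Finset α) {b : ℕ} (hb : 1 ≤ b) {δ : ℝ}
    (hδ0 : 0 ≤ δ) (hδ1 : δ ≤ 1) (X V : Finset α) (hXV : X ⊆ V)
    (hsum : ∑ i ∈ I, Real.exp (-(δ ^ 2 / (16 * (b + 1)) * #(F i ∩ X))) < 1) :
    MakerForces b (fun M => ∃ N : Finset α, (N : Set α) ⊆ M ∧ N ⊆ X ∧
      #N ≤ (#X + b) / (b + 1) ∧ ∀ i ∈ I, (1 - δ) / (b + 1) * #(F i ∩ X) ≤ #(F i ∩ N)) V ∅ := by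
  have hb' : (0 : ℝ) < b := by exact_mod_cast hb
  set a : ℝ := δ / 8 with ha
  set η : ℝ := a / b with hη
  set ζ : ℝ := η + (a + 3 * a ^ 2) with hζ
  set κ : ℝ := δ ^ 2 / (16 * (b + 1)) with hκ
  set c : ι → ℝ := fun i => Real.exp ((η - κ) * #(F i ∩ X)) with hc
  have hη0 : 0 ≤ η := by positivity
  have hbal : Real.exp (η * b) + Real.exp (η - ζ) ≤ 2 := by
    rw [show η * b = a by rw [hη]; field_simp, show η - ζ = -(a + 3 * a ^ 2) by rw [hζ]; ring]
    exact exp_add_exp_neg_le_two (by positivity) (by linarith)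
  have h0 : potential I c F η ζ X ∅ < 1 := by
    refine lt_of_eq_of_lt (Finset.sum_congr rfl fun i _ => ?_) hsum
    rw [hc, weight, ← Real.exp_add]
    congr 1
    simp only [Finset.inter_empty, Finset.card_empty, Nat.cast_zero]
    ring
  refine (makerForces_potential I (fun i _ => (Real.exp_pos _).le) F hb hη0 hbal X
    ((#X + b) / (b + 1)) V X ∅ ∅ hXV subset_rfl (Finset.empty_subset _) (by simp) (by simp) h0
    (by simp)).mono ?_
  rintro M ⟨N, hNM, hNX, hN, hpot⟩
  refine ⟨N, hNM, hNX, hN, fun i hi => ?_⟩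
  by_contra! hlt
  have hterm : c i * weight η ζ (F i) ∅ N < 1 := lt_of_le_of_lt
    (Finset.single_le_sum (f := fun i => c i * weight η ζ (F i) ∅ N)
      (fun j _ => mul_nonneg (Real.exp_pos _).le (Real.exp_pos _).le) hi) hpot
  rw [hc, weight, ← Real.exp_add, Real.exp_lt_one_iff] at hterm
  simp only [Finset.inter_empty, Finset.card_empty, Nat.cast_zero] at hterm
  set f : ℝ := (#(F i ∩ X) : ℝ)
  set m : ℝ := (#(F i ∩ N) : ℝ)
  have hf : 0 ≤ f := by positivity
  have hζ0 : 0 ≤ ζ := by positivity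
  have h1 : ζ * m ≤ ζ * ((1 - δ) / (b + 1) * f) := mul_le_mul_of_nonneg_left hlt.le hζ0
  have h2 : (η - κ) * f - ζ * ((1 - δ) / (b + 1) * f) =
      f / (b + 1) * (δ ^ 2 / 8 * ((b + 1) / b - 1) + δ ^ 2 / 64 + 3 * δ ^ 3 / 64) := by
    rw [hζ, hη, hκ, ha]; field_simp; ring
  have h3 : 0 ≤ f / (b + 1) * (δ ^ 2 / 8 * ((b + 1) / b - 1) + δ ^ 2 / 64 + 3 * δ ^ 3 / 64) := by
    have : (0 : ℝ) ≤ (b + 1) / b - 1 := by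
      rw [sub_nonneg, le_div_iff₀ hb']; linarith
    positivity
  linarith

/-! ### Several stages -/

/-- Maker can keep, for `s` stages, almost the fraction `1 / (b + 1) ^ s` of each of the sets
`F i`, inside a tracked set of about that fraction of the board. -/
lemma makerLasts_of_fraction (I : Finset ι) (F : ι → Finset α) {b : ℕ} (hb : 1 ≤ b) {δ : ℝ}
    (hδ0 : 0 ≤ δ) (hδ1 : δ ≤ 1) (s : ℕ) :
    ∀ (H : Hypergraph α) (V X : Finset α) (g : ι → ℝ) (K : ℝ), H.vertexSet = V → X ⊆ V →
    (∀ i ∈ I, 0 ≤ g i) → (∀ i ∈ I, g i ≤ #(F i ∩ X)) →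
    ∑ i ∈ I, Real.exp (-(δ ^ 2 / (16 * (b + 1)) * (((1 - δ) / (b + 1)) ^ s * g i))) < 1 →
    #X ≤ K + 2 →
    (∀ Z : Finset α, Z ⊆ X → #Z ≤ K / (b + 1) ^ s + 2 →
      (∀ i ∈ I, ((1 - δ) / (b + 1)) ^ s * g i ≤ #(F i ∩ Z)) → ∃ e ∈ H.edgeSet, e ⊆ Z) →
    MakerLasts b s H := by
  have hq0 : 0 ≤ (1 - δ) / ((b : ℝ) + 1) := div_nonneg (by linarith) (by positivity)
  have hq1 : (1 - δ) / ((b : ℝ) + 1) ≤ 1 := by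
    rw [div_le_one (by positivity)]
    have : (0 : ℝ) ≤ b := by positivity
    linarith
  induction s with
  | zero =>
    intro H V X g K _ _ _ hgX _ hK hfin
    obtain ⟨e, he, -⟩ := hfin X subset_rfl (by simpa using hK) (by simpa using hgX)
    exact ⟨e, he⟩
  | succ s ih =>
    intro H V X g K hHV hXV hg0 hgX hsum hK hfin
    show MakerForces b (fun M => MakerLasts b s (reduce H M)) H.vertexSet ∅
    rw [hHV]
    set q : ℝ := (1 - δ) / ((b : ℝ) + 1) with hq
    have hstage := makerForces_fraction I F hb hδ0 hδ1 X V hXV (lt_of_le_of_lt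
      (Finset.sum_le_sum fun i hi => Real.exp_le_exp.2 (neg_le_neg
        (mul_le_mul_of_nonneg_left (le_trans ?_ (hgX i hi)) (by positivity)))) hsum)
    swap
    · exact mul_le_of_le_one_left (hg0 i hi) (pow_le_one₀ hq0 hq1)
    refine (hstage.and_finite V.finite_toSet Set.finite_empty).mono ?_
    rintro M ⟨⟨N, hNM, hNX, hN, hfrac⟩, hM⟩
    refine ih (reduce H M) hM.toFinset N (fun i => q * g i) (K / (b + 1)) (by simp [reduce])
      (by simpa [← Finset.coe_subset] using hNM) (fun i hi => mul_nonneg hq0 (hg0 i hi))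
      (fun i hi => (mul_le_mul_of_nonneg_left (hgX i hi) hq0).trans (hfrac i hi)) ?_ ?_ ?_
    · simpa only [pow_succ, mul_assoc] using hsum
    · have h1 : (#N : ℝ) * (b + 1) ≤ #X + b := by
        exact_mod_cast (Nat.le_div_iff_mul_le (Nat.succ_pos b)).1 hN
      have hb' : (1 : ℝ) ≤ b := by exact_mod_cast hb
      rw [← sub_le_iff_le_add, le_div_iff₀ (by positivity)]
      nlinarith
    · intro Z hZN hZ hZi
      obtain ⟨e, he, heZ⟩ := hfin Z (hZN.trans hNX)
        (by rw [pow_succ', ← div_div]; exact hZ)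
        (fun i hi => by simpa only [pow_succ, mul_assoc] using hZi i hi)
      exact ⟨e, ⟨he, heZ.trans ((Finset.coe_subset.2 hZN).trans hNM)⟩, heZ⟩

/-- A set can be thinned out to a fraction of about `1 / (b + 1)` of its elements, keeping almost
that fraction of each of the sets `F i`. Such a subset is what Maker gets from the strategy in one
stage, even if Breaker never claims anything. -/
lemma exists_thinning (I : Finset ι) (F : ι → Finset α) {b : ℕ} (hb : 1 ≤ b) {δ : ℝ}
    (hδ0 : 0 ≤ δ) (hδ1 : δ ≤ 1) (X : Finset α)
    (hsum : ∑ i ∈ I, Real.exp (-(δ ^ 2 / (16 * (b + 1)) * #(F i ∩ X))) < 1) :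
    ∃ N ⊆ X, #N ≤ (#X + b) / (b + 1) ∧
      ∀ i ∈ I, (1 - δ) / (b + 1) * #(F i ∩ X) ≤ #(F i ∩ N) := by
  -- Breaker claims nothing
  have h : ∀ P : Set α → Prop, ∀ U M : Set α, MakerForces b P U M → ∃ M, P M := by
    intro P U M h
    induction h with
    | stageOver M h => exact ⟨M, h⟩
    | round U M x hx h ih => exact ih ∅ (Set.empty_subset _) (by simp)
  obtain ⟨M, N, -, hN⟩ := h _ _ _ (makerForces_fraction I F hb hδ0 hδ1 X X subset_rfl hsum)
  exact ⟨N, hN⟩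

end Potential

end Game

section Graph

variable {V : Type*}

/-! ### Paths as lists of vertices -/

/-- The edges between consecutive entries of a list. -/
def pathEdges : List V → Set (Sym2 V)
  | [] => ∅
  | [_] => ∅
  | a :: b :: l => insert s(a, b) (pathEdges (b :: l))

@[simp] lemma pathEdges_nil : pathEdges ([] : List V) = ∅ := rfl

@[simp] lemma pathEdges_singleton (a : V) : pathEdges [a] = ∅ := rfl

@[simp] lemma pathEdges_cons_cons (a b : V) (l : List V) :
    pathEdges (a :: b :: l) = insert s(a, b) (pathEdges (b :: l)) := rfl

lemma pathEdges_append_cons (l₁ : List V) (x : V) (l₂ : List V) :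
    pathEdges (l₁ ++ x :: l₂) = pathEdges (l₁ ++ [x]) ∪ pathEdges (x :: l₂) := by
  induction l₁ with
  | nil => simp
  | cons a l ih =>
    cases l with
    | nil => simp
    | cons b l =>
      simp only [List.cons_append, pathEdges_cons_cons] at ih ⊢
      rw [ih, Set.insert_union]

@[simp] lemma pathEdges_reverse (l : List V) : pathEdges l.reverse = pathEdges l := by
  induction l with
  | nil => rfl
  | cons a l ih =>
    cases l with
    | nil => rfl
    | cons b l =>
      rw [List.reverse_cons, List.reverse_cons, List.append_assoc, List.singleton_append,
        pathEdges_append_cons, ← List.reverse_cons, ih]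
      rw [pathEdges_cons_cons, pathEdges_singleton, Set.union_insert, Set.union_empty, Sym2.eq_swap]
      rfl

lemma pathEdges_cons {a b : V} {l : List V} (h : l.head? = some b) :
    pathEdges (a :: l) = insert s(a, b) (pathEdges l) := by
  cases l with
  | nil => simp at h
  | cons c l =>
    obtain rfl : c = b := by simpa using h
    rfl

lemma mem_of_mem_pathEdges {l : List V} {x y : V} (h : s(x, y) ∈ pathEdges l) : x ∈ l := by
  induction l with
  | nil => simp at h
  | cons a l ih =>
    cases l with
    | nil => simp at h
    | cons b l =>
      rw [pathEdges_cons_cons, Set.mem_insert_iff] at h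
      rcases h with h | h
      · rw [Sym2.eq_iff] at h
        rcases h with ⟨rfl, -⟩ | ⟨rfl, -⟩ <;> simp
      · exact List.mem_cons_of_mem _ (ih h)

/-- In a path, the first vertex has at most one neighbour. -/
lemma exists_neighbour_of_head (a : V) {l : List V} (h : (a :: l).Nodup) :
    ∃ f : V, ∀ w, s(a, w) ∈ pathEdges (a :: l) → w = f := by
  cases l with
  | nil => exact ⟨a, by simp⟩
  | cons b l =>
    refine ⟨b, fun w hw => ?_⟩
    rw [pathEdges_cons_cons, Set.mem_insert_iff] at hw
    rcases hw with hw | hw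
    · exact Sym2.congr_right.1 hw
    · exact absurd (mem_of_mem_pathEdges hw) (List.nodup_cons.1 h).1

/-- In a path, each vertex has at most two neighbours. -/
lemma exists_neighbours {l : List V} (h : l.Nodup) (v : V) :
    ∃ f g : V, ∀ w, s(v, w) ∈ pathEdges l → w = f ∨ w = g := by
  by_cases hv : v ∈ l
  · obtain ⟨l₁, l₂, rfl⟩ := List.append_of_mem hv
    obtain ⟨f, hf⟩ := exists_neighbour_of_head v
      (h.sublist (List.sublist_append_right l₁ (v :: l₂)))
    have h' : (v :: l₁.reverse).Nodup := by
      rw [List.nodup_append_comm, List.cons_append, List.nodup_cons, List.nodup_append_comm] at h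
      rw [List.nodup_cons, List.mem_reverse, List.nodup_reverse]
      exact ⟨fun hm => h.1 (by simp [hm]), h.2.sublist (List.sublist_append_left _ _)⟩
    obtain ⟨g, hg⟩ := exists_neighbour_of_head v h'
    refine ⟨f, g, fun w hw => ?_⟩
    rw [pathEdges_append_cons] at hw
    rcases hw with hw | hw
    · right
      refine hg w ?_
      rw [← pathEdges_reverse] at hw
      simpa using hw
    · exact .inl (hf w hw)
  · exact ⟨v, v, fun w hw => absurd (mem_of_mem_pathEdges hw) hv⟩

/-- The list `l` is the vertex sequence of a path all of whose edges are in `Γ`. -/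
def IsPathIn (Γ : Set (Sym2 V)) (l : List V) : Prop := l.Nodup ∧ pathEdges l ⊆ Γ

lemma IsPathIn.mono {Γ Γ' : Set (Sym2 V)} {l : List V} (h : IsPathIn Γ l) (hΓ : Γ ⊆ Γ') :
    IsPathIn Γ' l := ⟨h.1, h.2.trans hΓ⟩

lemma IsPathIn.reverse {Γ : Set (Sym2 V)} {l : List V} (h : IsPathIn Γ l) :
    IsPathIn Γ l.reverse := ⟨List.nodup_reverse.2 h.1, by rw [pathEdges_reverse]; exact h.2⟩

/-- `l` is a path in `Γ` with the largest number of vertices. -/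
def IsLongestPath (Γ : Set (Sym2 V)) (l : List V) : Prop :=
  IsPathIn Γ l ∧ ∀ l', IsPathIn Γ l' → l'.length ≤ l.length

lemma IsLongestPath.reverse {Γ : Set (Sym2 V)} {l : List V} (h : IsLongestPath Γ l) :
    IsLongestPath Γ l.reverse := ⟨h.1.reverse, by simpa using h.2⟩

lemma exists_isLongestPath [Fintype V] (Γ : Set (Sym2 V)) : ∃ l, IsLongestPath Γ l := by
  have hbdd : ∀ l : List V, IsPathIn Γ l → l.length ≤ Fintype.card V :=
    fun l hl => hl.1.length_le_card
  set S : Set ℕ := {m | ∃ l, IsPathIn Γ l ∧ l.length = m}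
  have hS : BddAbove S := ⟨Fintype.card V, by rintro m ⟨l, hl, rfl⟩; exact hbdd l hl⟩
  obtain ⟨l, hl, hlen⟩ := Nat.sSup_mem (s := S) ⟨0, [], ⟨by simp, by simp⟩, rfl⟩ hS
  exact ⟨l, hl, fun l' hl' => hlen ▸ le_csSup hS ⟨l', hl', rfl⟩⟩

/-- The neighbours of the last vertex of a longest path lie on the path. -/
lemma IsLongestPath.mem_of_mem {Γ : Set (Sym2 V)} {l : List V} (h : IsLongestPath Γ l) {a c : V}
    (ha : l.getLast? = some a) (hac : s(a, c) ∈ Γ) : c ∈ l := by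
  by_contra hc
  have h1 : IsPathIn Γ (c :: l.reverse) := by
    refine ⟨List.nodup_cons.2 ⟨by simpa using hc, List.nodup_reverse.2 h.1.1⟩, ?_⟩
    rw [pathEdges_cons (b := a) (by simpa using ha), pathEdges_reverse, Sym2.eq_swap]
    exact Set.insert_subset hac h.1.2
  have := h.2 _ h1
  simp at this

/-! ### Rotations -/

/-- The paths that arise from the path `l` by rotations that keep the first vertex: if the last
vertex `z` of a path has a neighbour `x` on it, the edge from `x` to its successor is
replaced by the edge from `x` to `z`. -/
inductive Rotation (Γ : Set (Sym2 V)) (l : List V) : List V → Prop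
  | refl : Rotation Γ l l
  | step (l₁ : List V) (x : V) (l₂ : List V) (z : V) (h : Rotation Γ l (l₁ ++ x :: l₂))
      (hz : l₂.getLast? = some z) (hxz : s(z, x) ∈ Γ) : Rotation Γ l (l₁ ++ x :: l₂.reverse)

lemma Rotation.perm {Γ : Set (Sym2 V)} {l l' : List V} (h : Rotation Γ l l') : l'.Perm l := by
  induction h with
  | refl => exact List.Perm.refl _
  | step l₁ x l₂ z _ _ _ ih =>
    exact (List.Perm.append_left _ ((List.reverse_perm l₂).cons x)).trans ih

lemma Rotation.head?_eq {Γ : Set (Sym2 V)} {l l' : List V} (h : Rotation Γ l l') :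
    l'.head? = l.head? := by
  induction h with
  | refl => rfl
  | step l₁ x l₂ z _ _ _ ih =>
    rw [← ih]
    cases l₁ <;> rfl

lemma Rotation.isPathIn {Γ : Set (Sym2 V)} {l l' : List V} (h : Rotation Γ l l')
    (hl : IsPathIn Γ l) : IsPathIn Γ l' := by
  refine ⟨h.perm.nodup_iff.2 hl.1, ?_⟩
  induction h with
  | refl => exact hl.2
  | step l₁ x l₂ z _ hz hxz ih =>
    rw [pathEdges_append_cons] at ih ⊢
    refine Set.union_subset (Set.subset_union_left.trans ih) ?_
    rw [pathEdges_cons (b := z) (by simpa using hz), pathEdges_reverse, Sym2.eq_swap]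
    refine Set.insert_subset hxz (Set.Subset.trans ?_ (Set.subset_union_right.trans ih))
    cases l₂ with
    | nil => simp
    | cons b l => exact Set.subset_insert _ _

lemma Rotation.isLongestPath {Γ : Set (Sym2 V)} {l l' : List V} (h : Rotation Γ l l')
    (hl : IsLongestPath Γ l) : IsLongestPath Γ l' :=
  ⟨h.isPathIn hl.1, fun l'' h'' => h.perm.length_eq ▸ hl.2 l'' h''⟩

lemma getLast?_append_cons_reverse (l₁ : List V) (x y : V) (l₂ : List V) :
    (l₁ ++ x :: (y :: l₂).reverse).getLast? = some y := by
  rw [List.reverse_cons, ← List.cons_append, ← List.append_assoc, List.getLast?_concat]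

/-- The last vertices of the paths that arise from `l` by rotations. -/
def rotationEnds (Γ : Set (Sym2 V)) (l : List V) : Set V :=
  {r | ∃ l', Rotation Γ l l' ∧ l'.getLast? = some r}

/-- A vertex that is not an end of a rotated path, and whose neighbours on `l` are not either, has
the same neighbours on all rotated paths. -/
lemma Rotation.mem_pathEdges_iff {Γ : Set (Sym2 V)} {l l' : List V} (h : Rotation Γ l l') {v : V}
    (hv : v ∉ rotationEnds Γ l) (hvl : ∀ w, s(v, w) ∈ pathEdges l → w ∉ rotationEnds Γ l) (w : V) :
    s(v, w) ∈ pathEdges l' ↔ s(v, w) ∈ pathEdges l := by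
  induction h generalizing w with
  | refl => rfl
  | step l₁ x l₂ z h hz hxz ih =>
    rw [← ih]
    have hzR : z ∈ rotationEnds Γ l := ⟨_, h, by
      cases l₂ with
      | nil => simp at hz
      | cons b l => simpa using hz⟩
    cases l₂ with
    | nil => simp at hz
    | cons y l₂ =>
      have hyR : y ∈ rotationEnds Γ l := ⟨_, .step l₁ x _ z h hz hxz, getLast?_append_cons_reverse ..⟩
      -- the edges `s(x, y)` and `s(z, x)` do not contain `v`
      have hvx : v ≠ x := by
        rintro rfl
        exact hvl y ((ih y).1 (by rw [pathEdges_append_cons]; simp)) hyR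
      have h1 : s(v, w) ≠ s(x, y) := by
        intro h
        rcases Sym2.eq_iff.1 h with ⟨h, -⟩ | ⟨rfl, -⟩
        · exact hvx h
        · exact hv hyR
      have h2 : s(v, w) ≠ s(x, z) := by
        intro h
        rcases Sym2.eq_iff.1 h with ⟨h, -⟩ | ⟨rfl, -⟩
        · exact hvx h
        · exact hv hzR
      rw [pathEdges_append_cons, pathEdges_append_cons l₁ x (y :: l₂),
        pathEdges_cons (b := z) (l := (y :: l₂).reverse) (by rwa [List.head?_reverse]), pathEdges_reverse,
        pathEdges_cons_cons]
      simp only [Set.mem_union, Set.mem_insert_iff, h1, h2, false_or]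

/-- **Pósa's lemma.** If `l` is a longest path, every neighbour of the set of ends of the rotated
paths belongs to this set or is a neighbour on `l` of one of its elements. -/
lemma IsLongestPath.exists_mem_pathEdges {Γ : Set (Sym2 V)} {l : List V} (hl : IsLongestPath Γ l)
    {r v : V} (hr : r ∈ rotationEnds Γ l) (hrv : s(r, v) ∈ Γ) (hv : v ∉ rotationEnds Γ l) :
    ∃ w ∈ rotationEnds Γ l, s(w, v) ∈ pathEdges l := by
  by_contra! hcon
  obtain ⟨l', hrot, hlast⟩ := hr
  have hvl : ∀ w, s(v, w) ∈ pathEdges l → w ∉ rotationEnds Γ l := fun w hw hwR =>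
    hcon w hwR (by rwa [Sym2.eq_swap])
  have hmem := (hrot.isLongestPath hl).mem_of_mem hlast hrv
  obtain ⟨l₁, l₂, rfl⟩ := List.append_of_mem hmem
  cases l₂ with
  | nil =>
    obtain rfl : v = r := by simpa using hlast
    exact hv ⟨_, hrot, hlast⟩
  | cons y l₂ =>
    have hyR : y ∈ rotationEnds Γ l := 
      ⟨_, .step l₁ v (y :: l₂) r hrot (by simpa using hlast) hrv, getLast?_append_cons_reverse ..⟩
    exact hvl y ((hrot.mem_pathEdges_iff hv hvl y).1 (by rw [pathEdges_append_cons]; simp)) hyR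

/-! ### Expanders -/

/-- Every nonempty set `A` of at most `k` vertices has more than `2 * #A` neighbours outside
`A`. -/
def Expands (Γ : Set (Sym2 V)) (k : ℕ) : Prop :=
  ∀ A B : Finset V, A.Nonempty → #A ≤ k → #B ≤ 2 * #A → ∃ a ∈ A, ∃ c, c ∉ A ∧ c ∉ B ∧ s(a, c) ∈ Γ

lemma Expands.mono {Γ Γ' : Set (Sym2 V)} {k : ℕ} (h : Expands Γ k) (hΓ : Γ ⊆ Γ') :
    Expands Γ' k := by
  intro A B hA hAk hB
  obtain ⟨a, ha, c, hcA, hcB, hac⟩ := h A B hA hAk hB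
  exact ⟨a, ha, c, hcA, hcB, hΓ hac⟩

lemma Expands.lt_card_rotationEnds [Finite V] {Γ : Set (Sym2 V)} {k : ℕ} (h : Expands Γ k)
    {l : List V} (hl : IsLongestPath Γ l) (hne : l ≠ []) : k < (rotationEnds Γ l).ncard := by
  classical
  have := Fintype.ofFinite V
  by_contra! hk
  choose f g hfg using fun v => exists_neighbours hl.1.1 v
  set R : Finset V := (rotationEnds Γ l).toFinset with hR
  have hmem : ∀ v, v ∈ R ↔ v ∈ rotationEnds Γ l := fun v => by simp [hR]
  rw [Set.ncard_eq_toFinset_card'] at hk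
  obtain ⟨a, ha, c, hcR, hcB, hac⟩ := h R (R.image f ∪ R.image g)
    ⟨l.getLast hne, (hmem _).2 ⟨l, .refl, List.getLast?_eq_some_getLast hne⟩⟩ hk
    ((Finset.card_union_le _ _).trans (by
      have := Finset.card_image_le (s := R) (f := f)
      have := Finset.card_image_le (s := R) (f := g)
      omega))
  obtain ⟨w, hw, hwc⟩ := hl.exists_mem_pathEdges ((hmem a).1 ha) hac (fun h => hcR ((hmem c).2 h))
  refine hcB (Finset.mem_union.2 ?_)
  rcases hfg w c hwc with h | h
  · exact .inl (Finset.mem_image.2 ⟨w, (hmem w).2 hw, h.symm⟩)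
  · exact .inr (Finset.mem_image.2 ⟨w, (hmem w).2 hw, h.symm⟩)

/-- Expansion up to a quarter of the vertices implies connectedness, here in the form that some
edge leaves `W`. -/
lemma Expands.exists_edge_leaving [Fintype V] [DecidableEq V] {Γ : Set (Sym2 V)} {k : ℕ}
    (h : Expands Γ k) (hk1 : 1 ≤ k) (hk : Fintype.card V ≤ 4 * k) {W : Finset V} (hkW : k ≤ #W)
    {v : V} (hv : v ∉ W) : ∃ x ∈ W, ∃ c ∉ W, s(x, c) ∈ Γ := by
  obtain ⟨A, hAW, hA⟩ := Finset.exists_subset_card_eq hkW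
  by_cases hB : #(W \ A) ≤ 2 * k
  · obtain ⟨a, ha, c, hcA, hcB, hac⟩ := h A (W \ A) (Finset.card_pos.1 (by omega)) hA.le
      (by omega)
    exact ⟨a, hAW ha, c, fun hc => hcB (Finset.mem_sdiff.2 ⟨hc, hcA⟩), hac⟩
  · rw [Finset.card_sdiff_of_subset hAW] at hB
    have hc := Finset.card_compl W
    obtain ⟨a, ha, c, hcA, -, hac⟩ := h Wᶜ ∅ ⟨v, by simpa using hv⟩ (by omega) (by simp)
    exact ⟨c, by simpa using hcA, a, by simpa using ha, by rwa [Sym2.eq_swap]⟩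

/-! ### Boosters -/

/-- There is a Hamilton cycle with edges in `Γ`: a path through all vertices whose last and first
vertices are joined by an edge of `Γ`. -/
def HasHamiltonCycle (Γ : Set (Sym2 V)) : Prop :=
  ∃ l a z, IsPathIn Γ l ∧ (∀ v, v ∈ l) ∧ l.head? = some a ∧ l.getLast? = some z ∧ s(z, a) ∈ Γ

lemma HasHamiltonCycle.mono {Γ Γ' : Set (Sym2 V)} (h : HasHamiltonCycle Γ) (hΓ : Γ ⊆ Γ') :
    HasHamiltonCycle Γ' := by
  obtain ⟨l, a, z, hl, hv, ha, hz, hza⟩ := h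
  exact ⟨l, a, z, hl.mono hΓ, hv, ha, hz, hΓ hza⟩

/-- The edge `e` is a booster for `Γ`: adding it makes the graph Hamiltonian or its longest path
longer. -/
def IsBooster (Γ : Set (Sym2 V)) (e : Sym2 V) : Prop :=
  ¬ e.IsDiag ∧ (HasHamiltonCycle (insert e Γ) ∨
    ∃ l, IsPathIn (insert e Γ) l ∧ ∀ l', IsPathIn Γ l' → l'.length < l.length)

/-- The ends of a longest path form a booster, because the cycle that the path and this edge
form is Hamiltonian or has an edge leaving it. -/
lemma IsLongestPath.isBooster [Fintype V] [DecidableEq V] {Γ : Set (Sym2 V)} {k : ℕ}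
    (h : Expands Γ k) (hk1 : 1 ≤ k) (hk : Fintype.card V ≤ 4 * k) {l : List V}
    (hl : IsLongestPath Γ l) (hkl : k < l.length) {a z : V} (ha : l.head? = some a)
    (hz : l.getLast? = some z) : IsBooster Γ s(a, z) := by
  refine ⟨?_, ?_⟩
  · rw [Sym2.mk_isDiag_iff]
    rintro rfl
    -- a list without repetitions whose ends coincide has one entry
    obtain ⟨t, rfl⟩ : ∃ t, l = a :: t := by
      cases l with
      | nil => simp at ha
      | cons b t => exact ⟨t, by simpa using ha⟩
    cases t with
    | nil => simp at hkl; omega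
    | cons b t =>
      have : a ∈ b :: t := List.mem_of_getLast? (by simpa using hz)
      exact (List.nodup_cons.1 hl.1.1).1 this
  · by_cases hall : ∀ v, v ∈ l
    · exact .inl ⟨l, a, z, hl.1.mono (Set.subset_insert _ _), hall, ha, hz, by
        rw [Sym2.eq_swap]; exact Set.mem_insert _ _⟩
    · right
      push Not at hall
      obtain ⟨v, hv⟩ := hall
      obtain ⟨x, hx, c, hc, hxc⟩ := h.exists_edge_leaving hk1 hk (W := l.toFinset) (v := v)
        (by rw [List.toFinset_card_of_nodup hl.1.1]; exact hkl.le) (by simpa using hv)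
      rw [List.mem_toFinset] at hx hc
      obtain ⟨l₁, l₂, rfl⟩ := List.append_of_mem hx
      refine ⟨c :: (x :: l₂ ++ l₁), ⟨?_, ?_⟩, fun l' hl' => ?_⟩
      · rw [List.nodup_cons, List.nodup_append_comm]
        exact ⟨by simpa [or_comm, or_assoc, or_left_comm] using hc, hl.1.1⟩
      · have h12 := hl.1.2
        rw [pathEdges_append_cons] at h12
        have h1 : pathEdges (x :: l₂) ⊆ Γ := Set.subset_union_right.trans h12
        have h2 : pathEdges (l₁ ++ [x]) ⊆ Γ := Set.subset_union_left.trans h12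
        rw [pathEdges_cons (b := x) (by simp)]
        refine Set.insert_subset (Set.mem_insert_of_mem _ (by rwa [Sym2.eq_swap])) ?_
        cases l₁ with
        | nil => simpa using h1.trans (Set.subset_insert _ _)
        | cons b l₁ =>
          obtain rfl : b = a := by simpa using ha
          have hl₁ : pathEdges (b :: l₁) ⊆ Γ := by
            refine Set.Subset.trans ?_ h2
            rw [← pathEdges_reverse, ← pathEdges_reverse (b :: l₁ ++ [x]), List.reverse_append,
              List.reverse_singleton, List.singleton_append]
            cases (b :: l₁).reverse with
            | nil => simp
            | cons _ _ => exact Set.subset_insert _ _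
          rw [pathEdges_append_cons]
          refine Set.union_subset ?_ (hl₁.trans (Set.subset_insert _ _))
          rw [← pathEdges_reverse, List.reverse_append, List.reverse_singleton,
            List.singleton_append, pathEdges_cons (b := z), pathEdges_reverse]
          · exact Set.insert_subset_insert h1
          · rw [List.head?_reverse]
            rwa [List.getLast?_append_of_ne_nil _ (by simp)] at hz
      · have := hl.2 l' hl'
        simp only [List.length_cons, List.length_append] at this ⊢
        omega

/-- An expander has quadratically many boosters. -/
lemma Expands.le_card_boosters [Fintype V] [DecidableEq V] [Nonempty V] {Γ : Set (Sym2 V)} {k : ℕ}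
    (h : Expands Γ k) (hk1 : 1 ≤ k) (hk : Fintype.card V ≤ 4 * k) (S : Finset (Sym2 V))
    (hS : ∀ e, IsBooster Γ e → e ∈ S) : k * k ≤ 2 * #S := by
  classical
  obtain ⟨l, hl⟩ := exists_isLongestPath Γ
  obtain ⟨v⟩ := ‹Nonempty V›
  have hne : l ≠ [] := by
    rintro rfl
    simpa using hl.2 [v] ⟨by simp, by simp⟩
  have hsub : ∀ l, IsLongestPath Γ l → (rotationEnds Γ l).ncard ≤ l.length := by
    intro l hl
    rw [← List.toFinset_card_of_nodup hl.1.1, ← Set.ncard_coe_finset]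
    refine Set.ncard_le_ncard ?_ (Finset.finite_toSet _)
    rintro r ⟨l', hrot, hr⟩
    simpa using hrot.perm.mem_iff.1 (List.mem_of_getLast? hr)
  have hkl : k < l.length := (h.lt_card_rotationEnds hl hne).trans_le (hsub l hl)
  -- each end `u` of a rotation of `l` is the first vertex of a longest path, whose rotations
  -- have many ends again
  have key : ∀ u ∈ rotationEnds Γ l, k ≤ #{w | s(u, w) ∈ S} := by
    rintro u ⟨l', hrot, hu⟩
    have hl' := (hrot.isLongestPath hl).reverse
    have hne' : l'.reverse ≠ [] := by
      rintro h
      simp only [List.reverse_eq_nil_iff] at h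
      simp [h] at hu
    refine (h.lt_card_rotationEnds hl' hne').le.trans ?_
    rw [← Set.ncard_coe_finset]
    refine Set.ncard_le_ncard ?_ (Finset.finite_toSet _)
    rintro w ⟨l'', hrot', hw⟩
    have hl'' := hrot'.isLongestPath hl'
    simp only [Finset.coe_filter, Finset.mem_univ, true_and, Set.mem_ofPred_eq]
    refine hS _ (hl''.isBooster h hk1 hk ?_ ?_ hw)
    · rw [hrot'.perm.length_eq, List.length_reverse, hrot.perm.length_eq]
      exact hkl
    · rw [hrot'.head?_eq, List.head?_reverse, hu]
  set R : Finset V := (rotationEnds Γ l).toFinset with hR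
  have hRk : k ≤ #R := by
    have := (h.lt_card_rotationEnds hl hne).le
    rwa [Set.ncard_eq_toFinset_card'] at this
  set O : Finset (Σ _ : V, V) := R.sigma fun u => ({w | s(u, w) ∈ S} : Finset V)
  have hO : k * k ≤ #O := by
    rw [Finset.card_sigma]
    calc k * k ≤ #R • k := by rw [smul_eq_mul]; exact Nat.mul_le_mul_right _ hRk
      _ ≤ _ := Finset.card_nsmul_le_sum _ _ _ fun u hu => key u (by simpa [hR] using hu)
  refine hO.trans (Finset.card_le_mul_card_image_of_maps_to (f := fun p => s(p.1, p.2)) ?_ 2 ?_)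
  · rintro ⟨u, w⟩ hp
    simpa using (Finset.mem_sigma.1 hp).2
  · intro e _
    induction e with
    | h x y =>
      refine (Finset.card_le_card (t := {⟨x, y⟩, ⟨y, x⟩}) ?_).trans Finset.card_le_two
      rintro ⟨u, w⟩ hp
      rcases Sym2.eq_iff.1 (Finset.mem_filter.1 hp).2 with ⟨h1, h2⟩ | ⟨h1, h2⟩ <;>
        simp only at h1 h2 <;> subst h1 h2 <;> simp

/-- If every expander with at most `m` edges has a booster in `Y`, and `Y` contains an expander
`Γ` with a path that misses at most `j` vertices, then `Y` is Hamiltonian, provided that `j` edges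
can be added to `Γ` within the bound `m`. -/
lemma hasHamiltonCycle_of_boosters [Fintype V] [DecidableEq V] {k m : ℕ} {Y : Set (Sym2 V)}
    (hY : ∀ Γ : Finset (Sym2 V), Expands (Γ : Set (Sym2 V)) k → #Γ ≤ m →
      ∃ e ∈ Y, IsBooster (Γ : Set (Sym2 V)) e) (j : ℕ) :
    ∀ (Γ : Finset (Sym2 V)) (l : List V), (Γ : Set (Sym2 V)) ⊆ Y →
      Expands (Γ : Set (Sym2 V)) k → #Γ + j ≤ m →
      IsPathIn (Γ : Set (Sym2 V)) l → Fintype.card V ≤ l.length + j → HasHamiltonCycle Y := by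
  induction j with
  | zero =>
    intro Γ l hΓY hexp hm hl hlen
    obtain ⟨e, heY, -, hham | ⟨l', hl', hlong⟩⟩ := hY Γ hexp (by omega)
    · exact hham.mono (Set.insert_subset heY hΓY)
    · have := hlong l hl
      have := hl'.1.length_le_card
      omega
  | succ j ih =>
    intro Γ l hΓY hexp hm hl hlen
    obtain ⟨e, heY, -, hham | ⟨l', hl', hlong⟩⟩ := hY Γ hexp (by omega)
    · exact hham.mono (Set.insert_subset heY hΓY)
    · have h1 := hlong l hl
      have h2 : #(insert e Γ) ≤ #Γ + 1 := Finset.card_insert_le _ _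
      refine ih (insert e Γ) l' ?_ ?_ (by omega) ?_ (by omega)
      · rw [Finset.coe_insert]
        exact Set.insert_subset heY hΓY
      · rw [Finset.coe_insert]
        exact hexp.mono (Set.subset_insert _ _)
      · rwa [Finset.coe_insert]

end Graph

/-! ### The Hamilton cycle hypergraph -/

section Walk

variable {V : Type*}

lemma exists_walk_of_nodup (l : List V) : ∀ a z : V, l.Nodup → l.head? = some a →
    l.getLast? = some z → ∃ p : (SimpleGraph.completeGraph V).Walk a z,
      p.support = l ∧ ∀ e, e ∈ p.edges ↔ e ∈ pathEdges l := by
  induction l with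
  | nil => simp
  | cons x l ih =>
    intro a z hl ha hz
    obtain rfl : x = a := by simpa using ha
    cases l with
    | nil =>
      obtain rfl : x = z := by simpa using hz
      exact ⟨.nil, by simp⟩
    | cons y l =>
      obtain ⟨p, hp, hpe⟩ := ih y z (List.nodup_cons.1 hl).2 (by simp) (by simpa using hz)
      have hxy : (SimpleGraph.completeGraph V).Adj x y := by
        rintro rfl
        simp at hl
      exact ⟨.cons hxy p, by simp [hp], fun e => by simp [hpe]⟩

end Walk

lemma exists_mem_edgeSet_HAM {n : ℕ} (hn : 3 ≤ n) {Y : Set (Sym2 (Fin n))}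
    (hY : HasHamiltonCycle Y) : ∃ F ∈ (HAM n).edgeSet, F ⊆ Y := by
  obtain ⟨l, a, z, hl, hall, ha, hz, hza⟩ := hY
  obtain ⟨p, hp, hpe⟩ := exists_walk_of_nodup l a z hl.1 ha hz
  have hpath : p.IsPath := SimpleGraph.Walk.IsPath.mk' (hp ▸ hl.1)
  have hlen : l.length = n := by
    have := (hpath.isHamiltonian_of_mem fun w => hp ▸ hall w).length_support
    rwa [hp, Fintype.card_fin] at this
  -- the closing edge is not an edge of the path, as the path has at least three vertices
  have hclose : s(z, a) ∉ p.edges := by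
    rw [hpe, Sym2.eq_swap]
    obtain ⟨x, y, w, t, rfl⟩ : ∃ x y w t, l = x :: y :: w :: t := by
      match l, hlen with
      | x :: y :: w :: t, _ => exact ⟨x, y, w, t, rfl⟩
      | [], h | [_], h | [_, _], h => simp at h; omega
    obtain rfl : x = a := by simpa using ha
    intro h
    rw [pathEdges_cons_cons, Set.mem_insert_iff] at h
    have hnd := hl.1
    rw [List.nodup_cons, List.nodup_cons] at hnd
    rcases h with h | h
    · obtain rfl := Sym2.congr_right.1 h
      exact hnd.2.1 (List.mem_of_getLast? (by simpa using hz))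
    · exact hnd.1 (mem_of_mem_pathEdges h)
  have hadj : (SimpleGraph.completeGraph (Fin n)).Adj z a := by
    rintro rfl
    have h1 := hl.1
    match l, hlen with
    | x :: y :: t, _ =>
      obtain rfl : x = z := by simpa using ha
      exact (List.nodup_cons.1 h1).1 (List.mem_of_getLast? (by simpa using hz))
    | [], h | [_], h => simp at h; omega
  refine ⟨_, ⟨z, .cons hadj p, ⟨?_, ?_⟩, rfl⟩, ?_⟩
  · exact (SimpleGraph.Walk.cons_isCycle_iff p hadj).2 ⟨hpath, hclose⟩
  · have h : p.IsHamiltonian := hpath.isHamiltonian_of_mem fun w => hp ▸ hall w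
    intro w
    simpa using h w
  · intro e he
    simp only [SimpleGraph.Walk.edgeSet, SimpleGraph.Walk.edges_cons, List.mem_cons,
      Set.mem_ofPred_eq] at he
    rcases he with rfl | he
    · exact hza
    · exact hl.2 ((hpe e).1 he)

lemma edgeSet_HAM_nonempty {n : ℕ} (hn : 3 ≤ n) : (HAM n).edgeSet.Nonempty := by
  obtain ⟨a, ha⟩ : ∃ a, (List.finRange n).head? = some a :=
    ⟨_, List.head?_eq_some_head (by simp; omega)⟩
  obtain ⟨z, hz⟩ : ∃ z, (List.finRange n).getLast? = some z :=
    ⟨_, List.getLast?_eq_some_getLast (by simp; omega)⟩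
  obtain ⟨F, hF, -⟩ := exists_mem_edgeSet_HAM hn (Y := Set.univ) ⟨List.finRange n, a, z,
    ⟨List.nodup_finRange n, Set.subset_univ _⟩, List.mem_finRange, ha, hz, Set.mem_univ _⟩
  exact ⟨F, hF⟩

lemma ncard_of_mem_edgeSet_HAM {n : ℕ} {F : Set (Sym2 (Fin n))} (hF : F ∈ (HAM n).edgeSet) :
    F.ncard = n := by
  obtain ⟨v, p, hp, rfl⟩ := hF
  have h : p.edgeSet = (p.edges.toFinset : Set (Sym2 (Fin n))) := by
    ext e; simp [SimpleGraph.Walk.edgeSet]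
  rw [h, Set.ncard_coe_finset, List.toFinset_card_of_nodup hp.isCycle.edges_nodup,
    SimpleGraph.Walk.length_edges, hp.length_eq, Fintype.card_fin]

lemma vertexSet_HAM (n : ℕ) :
    (HAM n).vertexSet = (({e | ¬ e.IsDiag} : Finset (Sym2 (Fin n))) : Set (Sym2 (Fin n))) := by
  ext e
  simp [HAM]

lemma ncard_vertexSet_HAM (n : ℕ) : (HAM n).vertexSet.ncard = n.choose 2 := by
  rw [vertexSet_HAM, Set.ncard_coe_finset, ← Fintype.card_subtype, Sym2.card_subtype_not_diag,
    Fintype.card_fin]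

/-- Breaker's bound: Maker survives at most `log_{b + 1} n` stages. -/
lemma pow_le_of_makerLasts {n b s : ℕ} (hn : 3 ≤ n) (h : MakerLasts b s (HAM n)) :
    (b + 1) ^ s ≤ n := by
  have h1 := MakerLasts.pow_mul_le (n := n) s (HAM n)
    (by rw [vertexSet_HAM]; exact Finset.finite_toSet _)
    (fun F hF => (ncard_of_mem_edgeSet_HAM hF).ge) h
  rw [ncard_vertexSet_HAM, Nat.choose_two_right] at h1
  have h2 : (b + 1) ^ s * (n - 1) ≤ n * (n - 1) := by
    have := Nat.div_le_self (n * (n - 1)) 2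
    omega
  exact Nat.le_of_mul_le_mul_right h2 (by omega)

/-! ### The sets in which Maker keeps her share -/

section Family

variable {V : Type*} [Fintype V] [DecidableEq V]

/-- The edges between `A` and the complement of `A ∪ B`. -/
def cut (A B : Finset V) : Finset (Sym2 V) :=
  (A ×ˢ (A ∪ B)ᶜ).image fun p => s(p.1, p.2)

lemma mem_cut {A B : Finset V} {e : Sym2 V} :
    e ∈ cut A B ↔ ∃ a ∈ A, ∃ c, c ∉ A ∧ c ∉ B ∧ s(a, c) = e := by
  simp only [cut, Finset.mem_image, Finset.mem_product, Finset.mem_compl, Finset.mem_union,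
    Prod.exists, not_or]
  grind

lemma card_cut (A B : Finset V) : #(cut A B) = #A * #(A ∪ B)ᶜ := by
  rw [cut, Finset.card_image_of_injOn, Finset.card_product]
  rintro ⟨a, c⟩ hac ⟨a', c'⟩ hac' h
  simp only [Finset.coe_product, Set.mem_prod, Finset.mem_coe, Finset.mem_compl,
    Finset.mem_union, not_or] at hac hac'
  rcases Sym2.eq_iff.1 h with ⟨rfl, rfl⟩ | ⟨rfl, rfl⟩
  · rfl
  · exact absurd hac.1 hac'.2.1

lemma not_isDiag_of_mem_cut {A B : Finset V} {e : Sym2 V} (he : e ∈ cut A B) : ¬ e.IsDiag := by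
  obtain ⟨a, ha, c, hcA, -, rfl⟩ := mem_cut.1 he
  rw [Sym2.mk_isDiag_iff]
  rintro rfl
  exact hcA ha

lemma le_card_cut {n : ℕ} (hn : 24 ≤ n) {A B : Finset (Fin n)} (hA : #A ≤ n / 4 + 1)
    (hB : #B ≤ 2 * #A) : (#A : ℝ) * (n / 8) ≤ #(cut A B) := by
  rw [card_cut, Nat.cast_mul]
  refine mul_le_mul_of_nonneg_left ?_ (Nat.cast_nonneg _)
  have h1 := Finset.card_compl (A ∪ B)
  have h2 := Finset.card_union_le A B
  rw [Fintype.card_fin] at h1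
  rw [div_le_iff₀ (by norm_num)]
  exact_mod_cast (by omega : n ≤ #(A ∪ B)ᶜ * 8)

/-- The pairs `(A, B)` that are relevant for expansion up to `k`. -/
def cutPairs (V : Type*) [Fintype V] (k : ℕ) : Finset (Finset V × Finset V) :=
  {p | p.1.Nonempty ∧ #p.1 ≤ k ∧ #p.2 ≤ 2 * #p.1}

omit [DecidableEq V] in
lemma mem_cutPairs {k : ℕ} {p : Finset V × Finset V} :
    p ∈ cutPairs V k ↔ p.1.Nonempty ∧ #p.1 ≤ k ∧ #p.2 ≤ 2 * #p.1 := by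
  simp [cutPairs]

lemma expands_of_cut {k : ℕ} {N : Finset (Sym2 V)}
    (h : ∀ p ∈ cutPairs V k, (cut p.1 p.2 ∩ N).Nonempty) : Expands (N : Set (Sym2 V)) k := by
  intro A B hA hAk hB
  obtain ⟨e, he⟩ := h (A, B) (mem_cutPairs.2 ⟨hA, hAk, hB⟩)
  obtain ⟨heC, heN⟩ := Finset.mem_inter.1 he
  obtain ⟨a, ha, c, hcA, hcB, rfl⟩ := mem_cut.1 heC
  exact ⟨a, ha, c, hcA, hcB, heN⟩

omit [DecidableEq V] in
lemma sum_pow_card (z : ℝ) : ∑ A : Finset V, z ^ #A = (1 + z) ^ Fintype.card V := by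
  have h := Finset.sum_pow_mul_eq_add_pow z 1 (Finset.univ : Finset V)
  simp only [one_pow, mul_one, Finset.powerset_univ, Finset.card_univ] at h
  rw [h, add_comm]

open Classical in
/-- The set of boosters of a graph. -/
noncomputable def boosters (Γ : Set (Sym2 V)) : Finset (Sym2 V) := {e | IsBooster Γ e}

omit [DecidableEq V] in
lemma mem_boosters {Γ : Set (Sym2 V)} {e : Sym2 V} : e ∈ boosters Γ ↔ IsBooster Γ e := by
  simp [boosters]

open Classical in
/-- The expanders with at most `m` edges. -/
noncomputable def sparseExpanders (V : Type*) [Fintype V] (k : ℕ) (m : ℝ) :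
    Finset (Finset (Sym2 V)) :=
  {Γ | Expands (Γ : Set (Sym2 V)) k ∧ (#Γ : ℝ) ≤ m}

omit [DecidableEq V] in
lemma mem_sparseExpanders {k : ℕ} {m : ℝ} {Γ : Finset (Sym2 V)} :
    Γ ∈ sparseExpanders V k m ↔ Expands (Γ : Set (Sym2 V)) k ∧ (#Γ : ℝ) ≤ m := by
  simp [sparseExpanders]

end Family

lemma exp_neg_two_mul_log {n : ℕ} (hn : 0 < n) :
    Real.exp (-(2 * Real.log n)) = 1 / (n : ℝ) ^ 2 := by
  have h : (0 : ℝ) < n := by exact_mod_cast hn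
  rw [Real.exp_neg, show 2 * Real.log n = Real.log ((n : ℝ) ^ 2) by rw [Real.log_pow]; norm_num,
    Real.exp_log (by positivity), one_div]

/-- The union bound over the cuts: each pair `(A, B)` contributes at most `z ^ #A * z ^ #B` with
`z = 1 / n ^ 2`. -/
lemma sum_cutPairs_lt {n : ℕ} (hn : 24 ≤ n) (k : ℕ) {r : ℝ}
    (hr : 6 * Real.log n ≤ r * (n / 8)) :
    ∑ p ∈ cutPairs (Fin n) k, Real.exp (-(r * (#p.1 * (n / 8)))) < 1 / 2 := by
  have hn0 : (0 : ℝ) < n := by exact_mod_cast (by omega : 0 < n)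
  have hn24 : (24 : ℝ) ≤ n := by exact_mod_cast hn
  have hlog : 0 ≤ Real.log n := Real.log_nonneg (by linarith)
  set z : ℝ := 1 / (n : ℝ) ^ 2 with hz
  have hz0 : 0 < z := by positivity
  have hzexp : ∀ j : ℕ, z ^ j = Real.exp (-(2 * Real.log n * j)) := by
    intro j
    rw [hz, ← exp_neg_two_mul_log (by omega), ← Real.exp_nat_mul]
    congr 1; ring
  have hterm : ∀ p ∈ cutPairs (Fin n) k,
      Real.exp (-(r * (#p.1 * (n / 8)))) ≤ z ^ #p.1 * z ^ #p.2 := by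
    intro p hp
    obtain ⟨-, -, hB⟩ := mem_cutPairs.1 hp
    rw [hzexp, hzexp, ← Real.exp_add, Real.exp_le_exp]
    have hB' : (#p.2 : ℝ) ≤ 2 * #p.1 := by exact_mod_cast hB
    have h1 : 6 * Real.log n * #p.1 ≤ r * (n / 8) * #p.1 :=
      mul_le_mul_of_nonneg_right hr (Nat.cast_nonneg _)
    have h2 : Real.log n * #p.2 ≤ Real.log n * (2 * #p.1) := mul_le_mul_of_nonneg_left hB' hlog
    nlinarith
  set P : ℝ := (1 + z) ^ n with hP
  have hP1 : P ≤ 1 + 1 / 12 := by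
    have h1 : P ≤ Real.exp (1 / n) := by
      calc P ≤ Real.exp z ^ n := pow_le_pow_left₀ (by positivity)
            (by linarith [Real.add_one_le_exp z]) _
        _ = Real.exp (1 / n) := by
            rw [← Real.exp_nat_mul, hz]; congr 1; field_simp
    have h2 : (1 : ℝ) / n ≤ 1 / 24 := one_div_le_one_div_of_le (by norm_num) hn24
    have h3 := Real.exp_bound_div_one_sub_of_interval (x := (1 : ℝ) / 24) (by norm_num) (by norm_num)
    calc P ≤ Real.exp (1 / 24) := h1.trans (Real.exp_le_exp.2 h2)
      _ ≤ 1 / (1 - 1 / 24) := h3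
      _ ≤ _ := by norm_num
  have hP0 : 1 ≤ P := one_le_pow₀ (by linarith)
  calc ∑ p ∈ cutPairs (Fin n) k, Real.exp (-(r * (#p.1 * (n / 8))))
      ≤ ∑ p ∈ cutPairs (Fin n) k, z ^ #p.1 * z ^ #p.2 := Finset.sum_le_sum hterm
    _ ≤ ∑ p ∈ (Finset.univ.erase (∅ : Finset (Fin n))) ×ˢ
          (Finset.univ : Finset (Finset (Fin n))), z ^ #p.1 * z ^ #p.2 := by
        refine Finset.sum_le_sum_of_subset_of_nonneg (fun p hp => ?_) fun _ _ _ => by positivity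
        simpa using (mem_cutPairs.1 hp).1.ne_empty
    _ = (P - 1) * P := by
        simp only [Finset.sum_product]
        rw [← Finset.sum_mul_sum, sum_pow_card, Fintype.card_fin]
        have := Finset.add_sum_erase Finset.univ (fun A : Finset (Fin n) => z ^ #A)
          (Finset.mem_univ ∅)
        rw [sum_pow_card, Fintype.card_fin, Finset.card_empty, pow_zero] at this
        rw [← hP] at this ⊢
        congr 1
        linarith
    _ < 1 / 2 := by nlinarith

/-- The union bound over the sets of boosters of sparse expanders. -/
lemma sum_sparseExpanders_lt {n : ℕ} (hn : 24 ≤ n) (k : ℕ) {m R : ℝ}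
    (hR : 2 * m * Real.log n + 3 ≤ R) :
    ∑ _Γ ∈ sparseExpanders (Fin n) k m, Real.exp (-R) < 1 / 2 := by
  have hn0 : (0 : ℝ) < n := by exact_mod_cast (by omega : 0 < n)
  have hn24 : (24 : ℝ) ≤ n := by exact_mod_cast hn
  have hlog : 0 ≤ Real.log n := Real.log_nonneg (by linarith)
  set z : ℝ := 1 / (n : ℝ) ^ 2 with hz
  have hz0 : 0 < z := by positivity
  have hterm : ∀ Γ ∈ sparseExpanders (Fin n) k m,
      Real.exp (-R) ≤ z ^ #Γ * Real.exp (-3) := by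
    intro Γ hΓ
    have hm := (mem_sparseExpanders.1 hΓ).2
    rw [hz, ← exp_neg_two_mul_log (by omega), ← Real.exp_nat_mul, ← Real.exp_add,
      Real.exp_le_exp]
    have : Real.log n * #Γ ≤ Real.log n * m := mul_le_mul_of_nonneg_left hm hlog
    nlinarith
  have hcard : (Fintype.card (Sym2 (Fin n)) : ℝ) ≤ (n : ℝ) ^ 2 := by
    rw [Sym2.card, Fintype.card_fin, Nat.choose_two_right]
    have h1 : (n + 1) * (n + 1 - 1) / 2 ≤ n ^ 2 :=
      Nat.div_le_of_le_mul (by simp only [Nat.add_sub_cancel]; nlinarith)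
    exact_mod_cast h1
  calc ∑ _Γ ∈ sparseExpanders (Fin n) k m, Real.exp (-R)
      ≤ ∑ Γ ∈ sparseExpanders (Fin n) k m, z ^ #Γ * Real.exp (-3) := Finset.sum_le_sum hterm
    _ ≤ ∑ Γ : Finset (Sym2 (Fin n)), z ^ #Γ * Real.exp (-3) :=
        Finset.sum_le_sum_of_subset_of_nonneg (Finset.subset_univ _) fun _ _ _ => by positivity
    _ = (1 + z) ^ Fintype.card (Sym2 (Fin n)) * Real.exp (-3) := by
        rw [← Finset.sum_mul, sum_pow_card]
    _ ≤ Real.exp 1 * Real.exp (-3) := by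
        refine mul_le_mul_of_nonneg_right ?_ (Real.exp_pos _).le
        calc (1 + z) ^ Fintype.card (Sym2 (Fin n))
            ≤ Real.exp z ^ Fintype.card (Sym2 (Fin n)) := pow_le_pow_left₀ (by positivity)
              (by linarith [Real.add_one_le_exp z]) _
          _ = Real.exp (Fintype.card (Sym2 (Fin n)) * z) := by rw [← Real.exp_nat_mul]
          _ ≤ Real.exp 1 := by
              rw [Real.exp_le_exp, hz, mul_one_div, div_le_one (by positivity)]
              exact hcard
    _ = Real.exp (-2) := by rw [← Real.exp_add]; norm_num
    _ < 1 / 2 := by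
        rw [Real.exp_neg, ← one_div]
        exact one_div_lt_one_div_of_lt (by norm_num)
          (by linarith [Real.add_one_lt_exp (x := 2) (by norm_num)])

/-- Maker survives `s` stages, under explicit conditions on the parameters. The auxiliary bias `b'`
governs the thinning of the final graph to a sparse expander, and `m` bounds the number of
edges of this expander together with all the boosters added to it. -/
lemma makerLasts_HAM {n b b' s : ℕ} {δ m : ℝ} (hn : 24 ≤ n) (hb : 1 ≤ b) (hb' : 1 ≤ b')
    (hδ0 : 0 ≤ δ) (hδ1 : δ ≤ 1)
    (hcut : 6 * Real.log n ≤ δ ^ 2 / (16 * (b + 1)) * (((1 - δ) / (b + 1)) ^ s * (n / 8)))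
    (hboost : 2 * m * Real.log n + 3 ≤
      δ ^ 2 / (16 * (b + 1)) * (((1 - δ) / (b + 1)) ^ s * ((n : ℝ) ^ 2 / 32)))
    (hthin : 6 * Real.log n ≤
      (1 / 2) ^ 2 / (16 * (b' + 1)) * (((1 - δ) / (b + 1)) ^ s * (n / 8)))
    (hm : ((n : ℝ) ^ 2 / (b + 1) ^ s + 2 + b') / (b' + 1) + n ≤ m) :
    MakerLasts b s (HAM n) := by
  classical
  have hn0 : (0 : ℝ) < n := by exact_mod_cast (by omega : 0 < n)
  have : NeZero n := ⟨by omega⟩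
  set k := n / 4 + 1 with hk
  set Q : ℝ := ((1 - δ) / (b + 1)) ^ s with hQ
  have hQ0 : 0 ≤ Q := pow_nonneg (div_nonneg (by linarith) (by positivity)) _
  have hlogpos : 0 < Real.log n := Real.log_pos (by exact_mod_cast (by omega : 1 < n))
  have hQpos : 0 < Q := by
    rcases hQ0.eq_or_lt with h | h
    · rw [← h] at hcut
      simp only [zero_mul, mul_zero] at hcut
      linarith
    · exact h
  set X : Finset (Sym2 (Fin n)) := {e | ¬ e.IsDiag} with hX
  have hXcard : (#X : ℝ) ≤ (n : ℝ) ^ 2 + 2 := by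
    have h1 : #X = n.choose 2 := by
      rw [← ncard_vertexSet_HAM, vertexSet_HAM, Set.ncard_coe_finset]
    have h2 : n.choose 2 ≤ n ^ 2 := Nat.choose_le_pow n 2
    rw [h1]
    have h3 : ((n.choose 2 : ℕ) : ℝ) ≤ (n : ℝ) ^ 2 := by exact_mod_cast h2
    linarith
  set I := (cutPairs (Fin n) k).disjSum (sparseExpanders (Fin n) k m) with hI
  set F : (Finset (Fin n) × Finset (Fin n)) ⊕ Finset (Sym2 (Fin n)) → Finset (Sym2 (Fin n)) :=
    Sum.elim (fun p => cut p.1 p.2) (fun Γ => boosters (Γ : Set (Sym2 (Fin n)))) with hF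
  set g : (Finset (Fin n) × Finset (Fin n)) ⊕ Finset (Sym2 (Fin n)) → ℝ :=
    Sum.elim (fun p => #p.1 * ((n : ℝ) / 8)) (fun _ => (n : ℝ) ^ 2 / 32) with hg
  refine makerLasts_of_fraction I F hb hδ0 hδ1 s (HAM n) X X g ((n : ℝ) ^ 2) (vertexSet_HAM n)
    subset_rfl ?_ ?_ ?_ hXcard ?_
  · rintro (p | Γ) _ <;> simp only [hg, Sum.elim_inl, Sum.elim_inr] <;> positivity
  · rintro (p | Γ) hi
    · obtain ⟨-, hA, hB⟩ := mem_cutPairs.1 (Finset.inl_mem_disjSum.1 hi)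
      have h1 : cut p.1 p.2 ∩ X = cut p.1 p.2 := Finset.inter_eq_left.2 fun e he => by
        simpa [hX] using not_isDiag_of_mem_cut he
      simp only [hF, hg, Sum.elim_inl, h1]
      exact le_card_cut hn hA hB
    · obtain ⟨hexp, -⟩ := mem_sparseExpanders.1 (Finset.inr_mem_disjSum.1 hi)
      have h1 : boosters (Γ : Set (Sym2 (Fin n))) ∩ X = boosters (Γ : Set (Sym2 (Fin n))) :=
        Finset.inter_eq_left.2 fun e he => by simpa [hX] using (mem_boosters.1 he).1
      simp only [hF, hg, Sum.elim_inr, h1]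
      have h2 := hexp.le_card_boosters (by omega) (by rw [Fintype.card_fin]; omega)
        (boosters (Γ : Set (Sym2 (Fin n)))) fun e he => mem_boosters.2 he
      have h3 : (k : ℝ) * k ≤ 2 * #(boosters (Γ : Set (Sym2 (Fin n)))) := by exact_mod_cast h2
      have h4 : (n : ℝ) ≤ 4 * k := by exact_mod_cast (by omega : n ≤ 4 * k)
      nlinarith
  · rw [hI, Finset.sum_disjSum]
    simp only [hg, Sum.elim_inl, Sum.elim_inr]
    have h1 := sum_cutPairs_lt hn k (r := δ ^ 2 / (16 * (b + 1)) * Q)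
      (by rw [mul_assoc]; exact hcut)
    have h2 := sum_sparseExpanders_lt hn k hboost
    simp only [mul_assoc] at h1 h2 ⊢
    linarith
  · intro Z hZX hZ hZF
    have hZcut : ∀ p ∈ cutPairs (Fin n) k, Q * (#p.1 * (n / 8)) ≤ #(cut p.1 p.2 ∩ Z) :=
      fun p hp => hZF (.inl p) (Finset.inl_mem_disjSum.2 hp)
    have hZboost : ∀ Γ ∈ sparseExpanders (Fin n) k m,
        Q * ((n : ℝ) ^ 2 / 32) ≤ #(boosters (Γ : Set (Sym2 (Fin n))) ∩ Z) :=
      fun Γ hΓ => hZF (.inr Γ) (Finset.inr_mem_disjSum.2 hΓ)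
    obtain ⟨N, hNZ, hN, hNcut⟩ := exists_thinning (cutPairs (Fin n) k)
      (fun p => cut p.1 p.2) hb' (δ := 1 / 2) (by norm_num) (by norm_num) Z (by
        refine lt_of_le_of_lt (Finset.sum_le_sum fun p hp => Real.exp_le_exp.2 (neg_le_neg
          (mul_le_mul_of_nonneg_left (hZcut p hp) (by positivity)))) ?_
        have h1 := sum_cutPairs_lt hn k (r := (1 / 2) ^ 2 / (16 * (b' + 1)) * Q)
          (by rw [mul_assoc]; exact hthin)
        simp only [mul_assoc] at h1 ⊢
        linarith)
    have hexp : Expands (N : Set (Sym2 (Fin n))) k := by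
      refine expands_of_cut fun p hp => ?_
      have hA : 0 < #p.1 := Finset.card_pos.2 (mem_cutPairs.1 hp).1
      have h1 : (0 : ℝ) < #(cut p.1 p.2 ∩ Z) := lt_of_lt_of_le (by positivity) (hZcut p hp)
      have h2 : (0 : ℝ) < #(cut p.1 p.2 ∩ N) :=
        lt_of_lt_of_le (mul_pos (by norm_num; positivity) h1) (hNcut p hp)
      exact Finset.card_pos.1 (by exact_mod_cast h2)
    have hNm : ((#N + n : ℕ) : ℝ) ≤ m := by
      refine le_trans ?_ hm
      push_cast
      gcongr
      rw [le_div_iff₀ (by positivity)]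
      have h1 : (#N : ℝ) * (b' + 1) ≤ #Z + b' := by
        exact_mod_cast (Nat.le_div_iff_mul_le (Nat.succ_pos b')).1 hN
      linarith
    refine exists_mem_edgeSet_HAM (by omega) (hasHamiltonCycle_of_boosters (k := k)
      (m := #N + n) ?_ n N [] (Finset.coe_subset.2 hNZ) hexp le_rfl ⟨by simp, by simp⟩ (by simp))
    intro Γ hΓ hΓm
    have h1 := hZboost Γ (mem_sparseExpanders.2 ⟨hΓ, le_trans (by exact_mod_cast hΓm) hNm⟩)
    have h2 : (0 : ℝ) < #(boosters (Γ : Set (Sym2 (Fin n))) ∩ Z) :=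
      lt_of_lt_of_le (by positivity) h1
    obtain ⟨e, he⟩ := Finset.card_pos.1 (by exact_mod_cast h2)
    exact ⟨e, (Finset.mem_inter.1 he).2, mem_boosters.1 (Finset.mem_inter.1 he).1⟩

/-! ### Asymptotics -/

lemma exp_neg_two_mul_le {δ : ℝ} (h0 : 0 ≤ δ) (h1 : δ ≤ 1 / 2) : Real.exp (-(2 * δ)) ≤ 1 - δ := by
  rw [Real.exp_neg, ← one_div]
  calc 1 / Real.exp (2 * δ) ≤ 1 / (1 + 2 * δ) :=
        one_div_le_one_div_of_le (by positivity) (by linarith [Real.add_one_le_exp (2 * δ)])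
    _ ≤ 1 - δ := by
        rw [div_le_iff₀ (by positivity)]
        nlinarith

/-- After `s = ⌊(1 - ε) log_B n⌋` stages the number of edges has decreased at least by the factor
`n / y ^ 9`, and all the sets that Maker controls at most by the factor `n / y ^ 7`, where
`y = n ^ (ε / 8)`. -/
lemma density_bounds {n B ε : ℝ} (hε0 : 0 < ε) (hε1 : ε < 1) (hn : 1 ≤ n) (hB2 : 2 ≤ B)
    (hBy : B ≤ n ^ (ε / 8)) :
    n ≤ B ^ ⌊(1 - ε) * Real.logb B n⌋₊ * (n ^ (ε / 8)) ^ 9 ∧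
      (n ^ (ε / 8)) ^ 7 / n ≤ ((1 - ε / 32) / B) ^ ⌊(1 - ε) * Real.logb B n⌋₊ := by
  have hn0 : 0 < n := by linarith
  have hL0 : 0 ≤ Real.log n := Real.log_nonneg hn
  have hB0 : 0 < B := by linarith
  set y : ℝ := n ^ (ε / 8) with hy
  set δ : ℝ := ε / 32 with hδ
  have hy0 : 0 < y := by positivity
  have hy8 : y ^ 8 = n ^ ε := by
    rw [hy, ← Real.rpow_natCast, ← Real.rpow_mul hn0.le]; congr 1; push_cast; ring
  set t : ℝ := (1 - ε) * Real.logb B n with ht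
  set s : ℕ := ⌊t⌋₊
  have hlogB : Real.log 2 ≤ Real.log B := Real.log_le_log (by norm_num) hB2
  have hlog2 : (1 : ℝ) / 2 ≤ Real.log 2 := by linarith [Real.log_two_gt_d9]
  have hlb0 : 0 ≤ Real.logb B n := div_nonneg hL0 (by linarith)
  have ht0 : 0 ≤ t := mul_nonneg (by linarith) hlb0
  have hst : (s : ℝ) ≤ t := Nat.floor_le ht0
  have hts : t < s + 1 := Nat.lt_floor_add_one t
  have hBt : B ^ t = n / y ^ 8 := by
    rw [ht, mul_comm, Real.rpow_mul hB0.le, Real.rpow_logb hB0 (by linarith) hn0,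
      Real.rpow_sub hn0, Real.rpow_one, hy8]
  have hD0 : 0 < B ^ s := by positivity
  have hDle : B ^ s * y ^ 8 ≤ n := by
    rw [← le_div_iff₀ (by positivity), ← hBt, ← Real.rpow_natCast]
    exact Real.rpow_le_rpow_of_exponent_le (by linarith) hst
  have hDge : n ≤ B ^ s * y ^ 9 := by
    have h1 : n / y ^ 8 ≤ B ^ s * B := by
      rw [← hBt, ← pow_succ, ← Real.rpow_natCast]
      exact Real.rpow_le_rpow_of_exponent_le (by linarith) (by push_cast; exact hts.le)
    rw [div_le_iff₀ (by positivity)] at h1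
    calc n ≤ B ^ s * B * y ^ 8 := h1
      _ ≤ B ^ s * y * y ^ 8 := by gcongr
      _ = _ := by ring
  have hs2 : (s : ℝ) ≤ 2 * Real.log n := by
    have h1 : Real.logb B n ≤ 2 * Real.log n := by
      rw [Real.logb, div_le_iff₀ (by linarith)]
      nlinarith
    nlinarith
  have hδs : 1 / y ≤ (1 - δ) ^ s := by
    calc 1 / y = Real.exp (-(4 * δ * Real.log n)) := by
          rw [hy, Real.rpow_def_of_pos hn0, one_div, ← Real.exp_neg, hδ]
          congr 1; ring
      _ ≤ Real.exp (s * -(2 * δ)) := by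
          rw [Real.exp_le_exp]
          have : 2 * δ * s ≤ 2 * δ * (2 * Real.log n) :=
            mul_le_mul_of_nonneg_left hs2 (by positivity)
          linarith
      _ = Real.exp (-(2 * δ)) ^ s := Real.exp_nat_mul _ _
      _ ≤ (1 - δ) ^ s := pow_le_pow_left₀ (Real.exp_pos _).le
          (exp_neg_two_mul_le (by positivity) (by linarith)) _
  refine ⟨hDge, ?_⟩
  · rw [div_pow, div_le_div_iff₀ hn0 hD0]
    have h1 : 1 ≤ (1 - δ) ^ s * y := by rwa [div_le_iff₀ hy0] at hδs
    calc y ^ 7 * B ^ s ≤ y ^ 7 * B ^ s * ((1 - δ) ^ s * y) :=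
          le_mul_of_one_le_right (by positivity) h1
      _ = (1 - δ) ^ s * (B ^ s * y ^ 8) := by ring
      _ ≤ (1 - δ) ^ s * n := mul_le_mul_of_nonneg_left hDle (pow_nonneg (by linarith) _)

/-- The number of edges after thinning with bias `b'`. -/
lemma thinning_le {n y D b' : ℝ} (hn : 1 ≤ n) (hy : 1 ≤ y) (hD : 0 < D) (hnD : n ≤ D * y ^ 9)
    (hb' : y ^ 4 ≤ b') : (n ^ 2 / D + 2 + b') / (b' + 1) + n ≤ 3 * (n * y ^ 5) := by
  have hy4 : 1 ≤ y ^ 4 := one_le_pow₀ hy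
  have hy5 : 1 ≤ y ^ 5 := one_le_pow₀ hy
  have h5 : n ≤ n * y ^ 5 := le_mul_of_one_le_right (by linarith) hy5
  have h1 : n ^ 2 / D ≤ n * y ^ 9 := by
    rw [div_le_iff₀ hD]
    calc n ^ 2 = n * n := sq n
      _ ≤ n * (D * y ^ 9) := by gcongr
      _ = _ := by ring
  have h3 : n * y ^ 9 ≤ n * y ^ 5 * b' := by
    calc n * y ^ 9 = n * y ^ 5 * y ^ 4 := by ring
      _ ≤ _ := by gcongr
  have h2 : (n ^ 2 / D + 2 + b') / (b' + 1) ≤ 2 * (n * y ^ 5) := by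
    rw [div_le_iff₀ (by linarith)]
    have h6 : b' ≤ n * y ^ 5 * b' := le_mul_of_one_le_left (by linarith) (hn.trans h5)
    linarith
  linarith

/-- Maker's bound: for large `n` she survives `⌊(1 - ε) log_{b + 1} n⌋` stages. -/
lemma makerLasts_floor {n b : ℕ} {ε : ℝ} (hε0 : 0 < ε) (hε1 : ε < 1) (hn : 24 ≤ n) (hb : 1 ≤ b)
    (hby : (b : ℝ) + 1 ≤ (n : ℝ) ^ (ε / 8))
    (hlog : 6 * Real.log n + 3 ≤ (ε / 32) ^ 2 / 512 * (n : ℝ) ^ (ε / 8)) :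
    MakerLasts b ⌊(1 - ε) * Real.logb (b + 1) n⌋₊ (HAM n) := by
  have hn24 : (24 : ℝ) ≤ n := by exact_mod_cast hn
  have hn1 : (1 : ℝ) ≤ n := by linarith
  have hn0 : (0 : ℝ) < n := by linarith
  have hL0 : 0 ≤ Real.log n := Real.log_nonneg hn1
  have hb' : (1 : ℝ) ≤ b := by exact_mod_cast hb
  obtain ⟨hDge, hQge⟩ := density_bounds hε0 hε1 hn1 (by linarith) hby
  set s : ℕ := ⌊(1 - ε) * Real.logb (b + 1) n⌋₊
  have hy1 : 1 ≤ (n : ℝ) ^ (ε / 8) := by linarith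
  generalize (n : ℝ) ^ (ε / 8) = y at *
  have hδ1 : ε / 32 ≤ 1 / 32 := by linarith
  have hδ0 : 0 ≤ ε / 32 := by positivity
  generalize ε / 32 = δ at *
  have hy0 : 0 < y := by linarith
  have hb'ge : y ^ 4 ≤ (⌈y ^ 4⌉₊ : ℕ) := Nat.le_ceil _
  have hb'le : ((⌈y ^ 4⌉₊ : ℕ) : ℝ) < y ^ 4 + 1 := Nat.ceil_lt_add_one (by positivity)
  have hy4 : 1 ≤ y ^ 4 := one_le_pow₀ hy1
  have hy3 : y ≤ y ^ 3 := le_self_pow₀ hy1 (by norm_num)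
  have hy5 : 1 ≤ y ^ 5 := one_le_pow₀ hy1
  have hy6 : y ≤ y ^ 6 := le_self_pow₀ hy1 (by norm_num)
  have hm := thinning_le hn1 hy1 (by positivity) hDge hb'ge
  have hκQ : δ ^ 2 / 16 * (y ^ 6 / n) ≤
      δ ^ 2 / (16 * ((b : ℝ) + 1)) * ((1 - δ) / ((b : ℝ) + 1)) ^ s := by
    calc δ ^ 2 / 16 * (y ^ 6 / n) = δ ^ 2 / (16 * y) * (y ^ 7 / n) := by field_simp
      _ ≤ δ ^ 2 / (16 * ((b : ℝ) + 1)) * (y ^ 7 / n) := by gcongr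
      _ ≤ _ := by gcongr
  generalize ⌈y ^ 4⌉₊ = b' at *
  refine makerLasts_HAM (δ := δ) (b' := b')
    (m := ((n : ℝ) ^ 2 / ((b : ℝ) + 1) ^ s + 2 + b') / (b' + 1) + n) hn hb
    (by exact_mod_cast hy4.trans hb'ge) hδ0 (by linarith) ?_ ?_ ?_ le_rfl
  · rw [← mul_assoc]
    calc 6 * Real.log n ≤ δ ^ 2 / 512 * y := by linarith
      _ ≤ δ ^ 2 / 128 * y ^ 6 := by gcongr; norm_num
      _ = δ ^ 2 / 16 * (y ^ 6 / n) * (n / 8) := by field_simp; ring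
      _ ≤ _ := by gcongr
  · rw [← mul_assoc]
    have h1 : (1 : ℝ) ≤ n * y ^ 5 := hn1.trans (le_mul_of_one_le_right hn0.le hy5)
    calc 2 * (((n : ℝ) ^ 2 / ((b : ℝ) + 1) ^ s + 2 + b') / (b' + 1) + n) * Real.log n + 3
        ≤ 2 * (3 * (n * y ^ 5)) * Real.log n + 3 * (n * y ^ 5) := by
          gcongr
          linarith
      _ = n * y ^ 5 * (6 * Real.log n + 3) := by ring
      _ ≤ n * y ^ 5 * (δ ^ 2 / 512 * y) := by gcongr
      _ = δ ^ 2 / 16 * (y ^ 6 / n) * ((n : ℝ) ^ 2 / 32) := by field_simp; ring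
      _ ≤ _ := by gcongr
  · rw [← mul_assoc]
    calc 6 * Real.log n ≤ δ ^ 2 / 512 * y := by linarith
      _ ≤ 1 / 1536 * y := by
          have : δ ^ 2 / 512 ≤ 1 / 1536 := by nlinarith
          gcongr
      _ ≤ 1 / 1536 * y ^ 3 := by gcongr
      _ = (1 / 2) ^ 2 / (16 * (3 * y ^ 4)) * (y ^ 7 / n) * (n / 8) := by field_simp; norm_num
      _ ≤ (1 / 2) ^ 2 / (16 * (b' + 1)) * ((1 - δ) / ((b : ℝ) + 1)) ^ s * (n / 8) := by
          gcongr
          linarith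

/-- The numbers of stages that Maker survives are bounded, and `0` is one of them. -/
lemma isGreatest_tau {n b : ℕ} (hn : 3 ≤ n) (hb : 1 ≤ b) :
    IsGreatest {s : ℕ | MakerLasts b s (HAM n)} (tau (HAM n) b) := by
  have hbdd : BddAbove {s : ℕ | MakerLasts b s (HAM n)} := by
    refine ⟨n, fun s hs => ?_⟩
    have h1 : (b + 1) ^ s ≤ n := pow_le_of_makerLasts hn hs
    exact (Nat.lt_pow_self (by omega)).le.trans h1
  have hne : {s : ℕ | MakerLasts b s (HAM n)}.Nonempty := ⟨0, edgeSet_HAM_nonempty hn⟩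
  exact ⟨Nat.sSup_mem hne hbdd, fun s hs => le_csSup hbdd hs⟩

lemma tau_le_logb {n b : ℕ} (hn : 3 ≤ n) (hb : 1 ≤ b) :
    (tau (HAM n) b : ℝ) ≤ Real.logb ((b : ℝ) + 1) n := by
  have h1 := pow_le_of_makerLasts hn (isGreatest_tau hn hb).1
  have hb' : (1 : ℝ) ≤ b := by exact_mod_cast hb
  rw [Real.le_logb_iff_rpow_le (by linarith) (by exact_mod_cast (by omega : 0 < n)),
    Real.rpow_natCast]
  exact_mod_cast h1

lemma le_tau {n b : ℕ} {ε : ℝ} (hε0 : 0 < ε) (hε1 : ε < 1) (hn : 24 ≤ n) (hb : 1 ≤ b)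
    (hby : (b : ℝ) + 1 ≤ (n : ℝ) ^ (ε / 8))
    (hlog : 6 * Real.log n + 3 ≤ (ε / 32) ^ 2 / 512 * (n : ℝ) ^ (ε / 8)) :
    (1 - 2 * ε) * Real.logb ((b : ℝ) + 1) n ≤ tau (HAM n) b := by
  have h1 : ⌊(1 - ε) * Real.logb ((b : ℝ) + 1) n⌋₊ ≤ tau (HAM n) b :=
    (isGreatest_tau (by omega) hb).2 (makerLasts_floor hε0 hε1 hn hb hby hlog)
  have h2 : (1 - ε) * Real.logb ((b : ℝ) + 1) n < (tau (HAM n) b : ℝ) + 1 :=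
    (Nat.lt_floor_add_one _).trans_le (by gcongr)
  have hb' : (1 : ℝ) ≤ b := by exact_mod_cast hb
  have hn0 : (0 : ℝ) < n := by exact_mod_cast (by omega : 0 < n)
  -- the loss from rounding down is small compared to the logarithm
  have h3 : 1 ≤ ε / 8 * Real.logb ((b : ℝ) + 1) n := by
    have hlogb : 0 < Real.log ((b : ℝ) + 1) := Real.log_pos (by linarith)
    have h4 := Real.log_le_log (by linarith) hby
    rw [Real.log_rpow hn0] at h4
    rw [Real.logb, ← mul_div_assoc, le_div_iff₀ hlogb, one_mul]
    exact h4
  nlinarith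

lemma eventually_log_le {ε : ℝ} (hε : 0 < ε) :
    ∀ᶠ n : ℕ in atTop, 6 * Real.log n + 3 ≤ (ε / 32) ^ 2 / 512 * (n : ℝ) ^ (ε / 8) := by
  have hc : 0 < (ε / 32) ^ 2 / 512 / 9 := by positivity
  have h1 := ((isLittleO_log_rpow_atTop (r := ε / 8) (by positivity)).comp_tendsto
    tendsto_natCast_atTop_atTop).bound hc
  filter_upwards [h1, eventually_ge_atTop 3] with n hn hn3
  have hn3' : (3 : ℝ) ≤ n := by exact_mod_cast hn3
  have hlog1 : 1 ≤ Real.log n := by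
    rw [Real.le_log_iff_exp_le (by linarith)]
    linarith [Real.exp_one_lt_d9]
  have hpow : 0 ≤ (n : ℝ) ^ (ε / 8) := by positivity
  simp only [Function.comp_apply, Real.norm_eq_abs, abs_of_nonneg hpow,
    abs_of_nonneg (zero_le_one.trans hlog1)] at hn
  linarith

lemma Subpolynomial.eventually_le {b : ℕ → ℕ} (hb : ∀ n, 1 ≤ b n) (h : Subpolynomial b) {ε : ℝ}
    (hε : 0 < ε) : ∀ᶠ n : ℕ in atTop, (b n : ℝ) + 1 ≤ (n : ℝ) ^ ε := by
  filter_upwards [(h ε hε).bound (c := 1 / 2) (by norm_num)] with n hn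
  have h1 : (1 : ℝ) ≤ b n := by exact_mod_cast hb n
  rw [Real.norm_of_nonneg (by positivity), Real.norm_of_nonneg (by positivity)] at hn
  linarith

end MultistageGame

theorem theorem1p1 (b : ℕ → ℕ) (hb : ∀ n, 1 ≤ b n)
    (hsub : MultistageGame.Subpolynomial b) :
    (∀ n, 3 ≤ n → IsGreatest {s : ℕ | MultistageGame.MakerLasts (b n) s (MultistageGame.HAM n)}
      (MultistageGame.tau (MultistageGame.HAM n) (b n))) ∧
    (fun n : ℕ => (MultistageGame.tau (MultistageGame.HAM n) (b n) : ℝ)) ~[atTop]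
      (fun n : ℕ => Real.logb ((b n : ℝ) + 1) (n : ℝ)) := by
  refine ⟨fun n hn => MultistageGame.isGreatest_tau hn (hb n), ?_⟩
  rw [IsEquivalent, isLittleO_iff]
  intro c hc
  set ε : ℝ := min (c / 2) (1 / 2) with hε
  have hε0 : 0 < ε := by positivity
  have hε1 : ε < 1 := (min_le_right _ _).trans_lt (by norm_num)
  have hεc : 2 * ε ≤ c := by linarith [min_le_left (c / 2) (1 / 2)]
  filter_upwards [hsub.eventually_le hb (ε := ε / 8) (by positivity),
    MultistageGame.eventually_log_le hε0, eventually_ge_atTop 24] with n h1 h2 hn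
  have hle := MultistageGame.tau_le_logb (n := n) (by omega) (hb n)
  have hge := MultistageGame.le_tau hε0 hε1 hn (hb n) h1 h2
  have hlogb : 0 ≤ Real.logb ((b n : ℝ) + 1) n := (Nat.cast_nonneg _).trans hle
  simp only [Pi.sub_apply, Real.norm_eq_abs, abs_of_nonneg hlogb]
  rw [abs_le]
  constructor <;> nlinarith
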